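/- Let $B$ be an injective self-adjoint operator on a (real or complex) Hilbert space $\mathcal H_0$. Let $\mathcal H_k$ ($k=1,2$) be $D(B^k)$ with the graph inner product, $\mathcal H_{-k}$ its dual (so $\mathcal H_0\subseteq\mathcal H_{-1}\subseteq\mathcal H_{-2}$), $\bar{\mathcal H}_1$ the completion of $D(B)$ for $\langle B\phi,B\varphi\rangle_0$, $\bar B:\bar{\mathcal H}_1\to\mathcal H_0$ the bounded extension of $B$, $\bar{\mathcal H}_2=\{\phi\in\bar{\mathcal H}_1:\bar B\phi\in D(B)\}$ with inner product $\langle\bar B\phi,\bar B\varphi\rangle_0+\langle B\bar B\phi,B\bar B\varphi\rangle_0$, and $\bar A=-B\bar B:\bar{\mathcal H}_2\to\mathcal H_0$. On $\bar{\mathcal H}_1\oplus\mathcal H_0$ let $W(\phi,\psi)=(\psi,\bar A\phi)$ with domain $\bar{\mathcal H}_2\oplus\mathcal H_1$. Let $\mathfrak h$ be a Hilbert space, $\Theta$ a bounded, positive, injective self-adjoint operator on $\mathfrak h$, $\mathfrak h_\Theta$ the space $\mathfrak h$ with the inner product $\langle\Theta\zeta,\eta\rangle_{\mathfrak h}$,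 and $\tau:\bar{\mathcal H}_2\to\mathfrak h$ bounded linear with dense range. For real $\lambda\ne0$ let $R_0(\lambda)=(B^2+\lambda^2)^{-1}$, let $\bar R_0(\lambda):\bar{\mathcal H}_1\to\bar{\mathcal H}_2$ be its bounded extension, $G(\lambda)=(\tau R_0(\lambda))^*:\mathfrak h\to\mathcal H_0$ and $\bar G(\lambda)=(\tau\bar R_0(\lambda))^*:\mathfrak h\to\bar{\mathcal H}_1$. Assume: * (H3.0) every element of $\mathfrak h$ has the form $\tau\phi-\Theta\zeta$ with $\phi\in\bar{\mathcal H}_2$, $\zeta\in\mathfrak h$; * (H3.1) $\mathrm{Ran}(\tau^*)\cap\mathcal H_{-1}=\{0\}$, where $\tau^*\zeta\in\mathcal H_{-2}$ is $\phi\mapsto\langle\zeta,\tau\phi\rangle_{\mathfrak h}$; * (H3.2) $\mathcal H_0$ and $\bar{\mathcal H}_1$ are contained in a common vector space $\mathcal V$, compatibly on $D(B)$ and with $\mathcal H_0\cap\bar{\mathcal H}_1=D(B)$. Then $G:=G(\lambda)+\lambda^2\bar G(\lambda):\mathfrak h\to\mathcal V$ does not depend on $\lambda$, and $(\phi_0,\zeta)\mapsto\phi_0+G\zeta$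 is injective on $\bar{\mathcal H}_1\times\mathfrak h$. Write $\phi=\phi_0+G\zeta_\phi$ for the elements of its range $\bar{\mathcal K}_1$, which carries the inner product $\langle\bar B\phi_0,\bar B\varphi_0\rangle_0+\langle\Theta\zeta_\phi,\zeta_\varphi\rangle_{\mathfrak h}$ (it is a Hilbert space if $\Theta$ is surjective); let $\bar{\mathcal K}_2=\{\phi\in\bar{\mathcal K}_1:\phi_0\in\bar{\mathcal H}_2\}$ and $\mathcal K_1=\bar{\mathcal K}_1\cap\mathcal H_0$. The operator $$W_\Theta(\phi,\psi)=(\psi,\bar A\phi_0),\qquad D(W_\Theta)=\{(\phi,\psi)\in\bar{\mathcal K}_2\oplus\mathcal K_1:\Theta\zeta_\phi=\tau\phi_0\},$$ on $\bar{\mathcal K}_1\oplus\mathcal H_0$ is skew-adjoint, i.e. densely defined with $W_\Theta^*=-W_\Theta$, and $-W_\Theta+\mu$ is onto for every real $\mu\neq0$. The map $U(\phi_0,\psi,\zeta)=(\phi_0+G\zeta,\psi)$ from $\bar{\mathcal H}_1\oplus\mathcal H_0\oplus\mathfrak h_\Theta$ onto $\bar{\mathcal K}_1\oplus\mathcal H_0$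 is unitary and $W_\Theta=U\tilde W_\Theta U^*$, where $\tilde W_\Theta$ is the (well-defined) operator $\tilde W_\Theta(\phi_0,\psi,\zeta)=(\psi_\lambda-\lambda^2\bar G(\lambda)\xi,\ \bar A\phi_0,\ \xi)$ on the vectors with $\phi_0\in\bar{\mathcal H}_2$, $\Theta\zeta=\tau\phi_0$ and $\psi=\psi_\lambda+G(\lambda)\xi$, $\psi_\lambda\in\mathcal H_1$, $\xi\in\mathfrak h$. The inclusion of $\bar{\mathcal H}_1\oplus\mathcal H_0$ in $\bar{\mathcal K}_1\oplus\mathcal H_0$ is isometric, $D(W)\cap D(W_\Theta)=\mathrm{Ker}(\tau)\oplus\mathcal H_1$, and $W_\Theta=W$ on this set. If this set is dense in $\bar{\mathcal H}_1\oplus\mathcal H_0$, then $W_\Theta$ is a singular perturbation of $W$ (both are skew-adjoint and they coincide on a dense subset of $\bar{\mathcal H}_1\oplus\mathcal H_0$); it is dense whenever $\tau$ is surjective. -/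

import Mathlib

open scoped InnerProductSpace

noncomputable section

namespace AbstractWave

/-! ### Skew-adjoint operators -/

section Skew

variable {𝕜 E F : Type*} [RCLike 𝕜]
variable [NormedAddCommGroup E] [InnerProductSpace 𝕜 E]
variable [NormedAddCommGroup F] [InnerProductSpace 𝕜 F]

/-- `T` is densely defined and its adjoint is `-T`. The adjoint is taken on the level of graphs, so
that the definition makes sense on an inner product space which need not be complete. -/
def IsSkewAdjoint (T : E →ₗ.[𝕜] E) : Prop :=
  Dense (T.domain : Set E) ∧ T.graph.adjoint = (-T).graph

/-- On a Hilbert space this is the usual notion. -/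
theorem isSkewAdjoint_iff [CompleteSpace E] (T : E →ₗ.[𝕜] E) :
    IsSkewAdjoint T ↔ Dense (T.domain : Set E) ∧ T.adjoint = -T := by
  refine and_congr_right fun h => ?_
  rw [← LinearPMap.adjoint_graph_eq_graph_adjoint h]
  exact ⟨LinearPMap.eq_of_eq_graph, fun h => by rw [h]⟩

/-- For `E` embedded in `F` by `J`: the skew-adjoint operator `S` on `F` is a singular perturbation
of the skew-adjoint operator `T` on `E` if the set of the vectors in both domains on which the two
operators coincide is dense in `E`. -/
def IsSingularPerturbation (J : E →ₗ[𝕜] F) (T : E →ₗ.[𝕜] E) (S : F →ₗ.[𝕜] F) : Prop :=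
  IsSkewAdjoint T ∧ IsSkewAdjoint S ∧
    Dense {x : E | ∃ (hx : x ∈ T.domain) (hJx : J x ∈ S.domain), S ⟨J x, hJx⟩ = J (T ⟨x, hx⟩)}

end Skew

/-! ### The spaces `H₁`, `H₂`, `H̄₁`, `H̄₂` of an operator `B` -/

section Spaces

variable {𝕜 H : Type*} [RCLike 𝕜] [NormedAddCommGroup H] [InnerProductSpace 𝕜 H]

/-- `B²`, on its natural domain. -/
def sq (B : H →ₗ.[𝕜] H) : H →ₗ.[𝕜] H where
  domain := (B.domain.comap B.toFun).map B.domain.subtype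
  toFun :=
    { toFun := fun x => B ⟨B ⟨x, by obtain ⟨y, -, h⟩ := x.2; exact h ▸ y.2⟩, by
        obtain ⟨y, hy, h⟩ := x.2
        have : y = ⟨x, h ▸ y.2⟩ := Subtype.ext h
        exact this ▸ hy⟩
      map_add' := fun x y => by
        rw [← B.map_add]; congr 1; ext1
        exact B.map_add ⟨x, _⟩ ⟨y, _⟩
      map_smul' := fun c x => by
        rw [RingHom.id_apply, ← B.map_smul]; congr 1; ext1
        exact B.map_smul c ⟨x, _⟩ }

theorem mem_sq_domain {B : H →ₗ.[𝕜] H} {x : H} :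
    x ∈ (sq B).domain ↔ ∃ hx : x ∈ B.domain, B ⟨x, hx⟩ ∈ B.domain := by
  constructor
  · rintro ⟨y, hy, rfl⟩; exact ⟨y.2, hy⟩
  · rintro ⟨hx, h⟩; exact ⟨⟨x, hx⟩, h, rfl⟩

theorem sq_domain_le (B : H →ₗ.[𝕜] H) : (sq B).domain ≤ B.domain :=
  fun _ hx => (mem_sq_domain.1 hx).1

/-- The domain of an operator `T`, with the inner product `⟪T x, T y⟫ + ⟪x, y⟫` of its graph. -/
def GraphDom (T : H →ₗ.[𝕜] H) : Type _ := T.domain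

instance (T : H →ₗ.[𝕜] H) : AddCommGroup (GraphDom T) := inferInstanceAs (AddCommGroup T.domain)
instance (T : H →ₗ.[𝕜] H) : Module 𝕜 (GraphDom T) := inferInstanceAs (Module 𝕜 T.domain)

/-- `x ↦ (T x, x)`. -/
def GraphDom.emb (T : H →ₗ.[𝕜] H) : GraphDom T →ₗ[𝕜] WithLp 2 (H × H) :=
  (WithLp.linearEquiv 2 𝕜 (H × H)).symm.toLinearMap ∘ₗ T.toFun.prod T.domain.subtype

instance (T : H →ₗ.[𝕜] H) : NormedAddCommGroup (GraphDom T) :=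
  NormedAddCommGroup.induced _ _ (GraphDom.emb T) fun _ _ h =>
    Subtype.ext (congrArg (fun z : WithLp 2 (H × H) => z.snd) h)
instance (T : H →ₗ.[𝕜] H) : InnerProductSpace 𝕜 (GraphDom T) := InnerProductSpace.induced (GraphDom.emb T)

/-- `H₁`: the domain of `B` with the graph inner product. -/
abbrev H1 (B : H →ₗ.[𝕜] H) : Type _ := GraphDom B

/-- `H₂`: the domain of `B²` with the graph inner product. -/
abbrev H2 (B : H →ₗ.[𝕜] H) : Type _ := GraphDom (sq B)

/-- The domain of `B` with the inner product `⟪B x, B y⟫`. -/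
def EnergyDom (B : H →ₗ.[𝕜] H) : Type _ := B.domain

instance (B : H →ₗ.[𝕜] H) : AddCommGroup (EnergyDom B) := inferInstanceAs (AddCommGroup B.domain)
instance (B : H →ₗ.[𝕜] H) : Module 𝕜 (EnergyDom B) := inferInstanceAs (Module 𝕜 B.domain)

/-- `B` as a linear map on its domain. -/
def EnergyDom.op (B : H →ₗ.[𝕜] H) : EnergyDom B →ₗ[𝕜] H := B.toFun

instance (B : H →ₗ.[𝕜] H) : SeminormedAddCommGroup (EnergyDom B) :=
  SeminormedAddCommGroup.induced _ _ (EnergyDom.op B)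
instance (B : H →ₗ.[𝕜] H) : InnerProductSpace 𝕜 (EnergyDom B) := InnerProductSpace.induced (EnergyDom.op B)

/-- `H̄₁`: the completion of the domain of `B` for the inner product `⟪B x, B y⟫`. -/
abbrev Hbar1 (B : H →ₗ.[𝕜] H) : Type _ := UniformSpace.Completion (EnergyDom B)

/-- The canonical map from the domain of `B` to `H̄₁`. -/
def toHbar1 (B : H →ₗ.[𝕜] H) : B.domain →ₗ[𝕜] Hbar1 B :=
  (UniformSpace.Completion.toComplL : EnergyDom B →L[𝕜] Hbar1 B).toLinearMap

variable [CompleteSpace H]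

/-- `B̄ : H̄₁ → H`: the bounded extension of `B`. -/
def Bbar (B : H →ₗ.[𝕜] H) : Hbar1 B →L[𝕜] H :=
  ((EnergyDom.op B).mkContinuous 1 fun x => (one_mul ‖x‖).ge).extend
    UniformSpace.Completion.toComplL

theorem Bbar_coe (B : H →ₗ.[𝕜] H) (x : B.domain) : Bbar B (toHbar1 B x) = B x :=
  ContinuousLinearMap.extend_eq _ UniformSpace.Completion.denseRange_coe
    (UniformSpace.Completion.isUniformInducing_coe (EnergyDom B)) _

theorem norm_Bbar (B : H →ₗ.[𝕜] H) (φ : Hbar1 B) : ‖Bbar B φ‖ = ‖φ‖ := by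
  induction φ using UniformSpace.Completion.induction_on with
  | hp => exact isClosed_eq (by fun_prop) (by fun_prop)
  | ih x =>
    rw [UniformSpace.Completion.norm_coe]
    exact congrArg norm (Bbar_coe B x)

/-- The vectors `φ` of `H̄₁` with `B̄ φ` in the domain of `B`. -/
def hbar2 (B : H →ₗ.[𝕜] H) : Submodule 𝕜 (Hbar1 B) := B.domain.comap (Bbar B).toLinearMap

/-- `H̄₂`: its inner product is `⟪B B̄ φ, B B̄ ψ⟫ + ⟪B̄ φ, B̄ ψ⟫`. -/
def Hbar2 (B : H →ₗ.[𝕜] H) : Type _ := hbar2 B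

instance (B : H →ₗ.[𝕜] H) : AddCommGroup (Hbar2 B) := inferInstanceAs (AddCommGroup (hbar2 B))
instance (B : H →ₗ.[𝕜] H) : Module 𝕜 (Hbar2 B) := inferInstanceAs (Module 𝕜 (hbar2 B))

/-- `φ ↦ B̄ φ`, from `H̄₂` to `H₁`. -/
def Hbar2.emb (B : H →ₗ.[𝕜] H) : Hbar2 B →ₗ[𝕜] H1 B :=
  ((Bbar B).toLinearMap.domRestrict (hbar2 B)).codRestrict B.domain fun φ => φ.2

instance (B : H →ₗ.[𝕜] H) : NormedAddCommGroup (Hbar2 B) :=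
  NormedAddCommGroup.induced _ _ (Hbar2.emb B) fun φ ψ h => Subtype.ext <| by
    have h' : Bbar B φ.1 = Bbar B ψ.1 := congrArg Subtype.val h
    rw [← sub_eq_zero, ← norm_eq_zero, ← norm_Bbar B, map_sub, h', sub_self, norm_zero]
instance (B : H →ₗ.[𝕜] H) : InnerProductSpace 𝕜 (Hbar2 B) := InnerProductSpace.induced (Hbar2.emb B)

/-- An element of `H̄₁` which lies in `H̄₂`, as an element of `H̄₂`. -/
def Hbar2.mk {B : H →ₗ.[𝕜] H} (φ : Hbar1 B) (hφ : φ ∈ hbar2 B) : Hbar2 B :=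
  (⟨φ, hφ⟩ : hbar2 B)

/-- The inclusion of `H̄₂` in `H̄₁`. -/
def Hbar2.incl (B : H →ₗ.[𝕜] H) : Hbar2 B →ₗ[𝕜] Hbar1 B := (hbar2 B).subtype

/-- `Ā = - B B̄`. -/
def Abar (B : H →ₗ.[𝕜] H) : Hbar2 B →ₗ[𝕜] H := -(B.toFun ∘ₗ Hbar2.emb B)

/-- The inclusion of the domain of `B²` in `H̄₂`. -/
def toHbar2 (B : H →ₗ.[𝕜] H) : (sq B).domain →ₗ[𝕜] Hbar2 B :=
  (toHbar1 B ∘ₗ Submodule.inclusion (sq_domain_le B)).codRestrict (hbar2 B) fun x => by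
    change Bbar B (toHbar1 B _) ∈ B.domain
    rw [Bbar_coe]
    exact (mem_sq_domain.1 x.2).2

end Spaces

/-! ### The resolvents of `B²` -/

section Resolvent

variable {𝕜 H : Type*} [RCLike 𝕜] [NormedAddCommGroup H] [InnerProductSpace 𝕜 H] [CompleteSpace H]
variable {B : H →ₗ.[𝕜] H}

theorem symm_of_sa (hB : IsSelfAdjoint B) (x y : B.domain) :
    inner 𝕜 (B x) (y : H) = inner 𝕜 (x : H) (B y) := by
  have h := LinearPMap.adjoint_isFormalAdjoint hB.dense_domain
  rw [LinearPMap.isSelfAdjoint_def.1 hB] at h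
  exact h x y

theorem mem_of_sa (hB : IsSelfAdjoint B) (y w : H)
    (h : ∀ x : B.domain, inner 𝕜 w (x : H) = inner 𝕜 y (B x)) :
    ∃ hy : y ∈ B.domain, B ⟨y, hy⟩ = w := by
  have h1 : y ∈ B.adjoint.domain := LinearPMap.mem_adjoint_domain_of_exists y ⟨w, h⟩
  have h2 := LinearPMap.adjoint_apply_eq hB.dense_domain ⟨y, h1⟩ h
  have h3 : (y, w) ∈ B.adjoint.graph := h2 ▸ B.adjoint.mem_graph ⟨y, h1⟩
  rw [LinearPMap.isSelfAdjoint_def.1 hB, LinearPMap.mem_graph_iff] at h3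
  obtain ⟨z, hz, hz'⟩ := h3
  obtain rfl : (z : H) = y := hz
  exact ⟨z.2, hz'⟩

/-- `B² + l²`, as a linear map on the domain of `B²`. -/
def sqAdd (B : H →ₗ.[𝕜] H) (l : ℝ) : (sq B).domain →ₗ[𝕜] H :=
  (sq B).toFun + ((l : 𝕜) ^ 2) • (sq B).domain.subtype

theorem norm_sqAdd (hB : IsSelfAdjoint B) (l : ℝ) (u : (sq B).domain) :
    ‖sqAdd B l u‖ ^ 2 = ‖sq B u‖ ^ 2 + 2 * l ^ 2 * ‖B ⟨u, sq_domain_le B u.2⟩‖ ^ 2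
      + l ^ 4 * ‖(u : H)‖ ^ 2 := by
  have h : sqAdd B l u = sq B u + ((l ^ 2 : ℝ) : 𝕜) • (u : H) := by
    simp [sqAdd]
  have h2 : inner 𝕜 (sq B u) (u : H) =
      inner 𝕜 (B ⟨u, sq_domain_le B u.2⟩) (B ⟨u, sq_domain_le B u.2⟩) :=
    symm_of_sa hB ⟨B ⟨u, sq_domain_le B u.2⟩, (mem_sq_domain.1 u.2).2⟩ ⟨u, sq_domain_le B u.2⟩
  rw [h, norm_add_sq (𝕜 := 𝕜), inner_smul_right, RCLike.re_ofReal_mul, h2, inner_self_eq_norm_sq,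
    norm_smul, RCLike.norm_ofReal, mul_pow, sq_abs]
  ring

theorem sqAdd_surjective (hB : IsSelfAdjoint B) {l : ℝ} (hl : l ≠ 0) :
    Function.Surjective (sqAdd B l) := by
  intro f
  have hl' : (l : 𝕜) ≠ 0 := by exact_mod_cast hl
  let q : WithLp 2 (H × H) →L[𝕜] H × H :=
    (((l : 𝕜)⁻¹ • ContinuousLinearMap.fst 𝕜 H H).prod (ContinuousLinearMap.snd 𝕜 H H)).comp
      (WithLp.prodContinuousLinearEquiv 2 𝕜 H H).toContinuousLinearMap
  let K : Submodule 𝕜 (WithLp 2 (H × H)) := B.graph.comap q.toLinearMap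
  have hK : IsClosed (K : Set (WithLp 2 (H × H))) := IsClosed.preimage q.continuous hB.isClosed
  have : CompleteSpace K := hK.completeSpace_coe
  have hmem : ∀ z : WithLp 2 (H × H), z ∈ K ↔ ((l : 𝕜)⁻¹ • z.fst, z.snd) ∈ B.graph :=
    fun z => Iff.rfl
  let p : WithLp 2 (H × H) := WithLp.toLp 2 ((l : 𝕜)⁻¹ • f, 0)
  obtain ⟨w, hw, w', hw', hp⟩ := K.exists_add_mem_mem_orthogonal p
  have hw1 := (hmem w).1 hw
  rw [LinearPMap.mem_graph_iff] at hw1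
  obtain ⟨u, hu, hBu⟩ := hw1
  have hu' : w.fst = (l : 𝕜) • (u : H) := by
    have : (u : H) = (l : 𝕜)⁻¹ • w.fst := hu
    rw [this, smul_smul, mul_inv_cancel₀ hl', one_smul]
  have hBu' : B u = w.snd := hBu
  have hp1 : (l : 𝕜)⁻¹ • f = w.fst + w'.fst := congrArg (fun z : WithLp 2 (H × H) => z.fst) hp
  have hp2 : (0 : H) = w.snd + w'.snd := congrArg (fun z : WithLp 2 (H × H) => z.snd) hp
  have key : ∀ v : B.domain, inner 𝕜 (f - ((l : 𝕜) ^ 2) • (u : H)) (v : H)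
      = inner 𝕜 (B u) (B v) := by
    intro v
    have hv : WithLp.toLp 2 ((l : 𝕜) • (v : H), B v) ∈ K := by
      rw [hmem]
      simp only [WithLp.toLp_fst, WithLp.toLp_snd, smul_smul, inv_mul_cancel₀ hl', one_smul]
      exact B.mem_graph v
    have h0 := Submodule.inner_left_of_mem_orthogonal hv hw'
    rw [WithLp.prod_inner_apply] at h0
    simp only [WithLp.ofLp_fst, WithLp.ofLp_snd] at h0
    have e1 : w'.fst = (l : 𝕜)⁻¹ • (f - ((l : 𝕜) ^ 2) • (u : H)) := by
      rw [smul_sub, hp1, hu', smul_smul, pow_two, ← mul_assoc, inv_mul_cancel₀ hl', one_mul]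
      abel
    have e2 : w'.snd = - B u := by rw [hBu']; exact (neg_eq_of_add_eq_zero_right hp2.symm).symm
    rw [e1, e2, inner_smul_left, inner_smul_right, inner_neg_left, ← mul_assoc] at h0
    simp only [map_inv₀, RCLike.conj_ofReal, inv_mul_cancel₀ hl', one_mul] at h0
    linear_combination h0
  obtain ⟨hy, hBB⟩ := mem_of_sa hB (B u) _ key
  refine ⟨⟨u, mem_sq_domain.2 ⟨u.2, hy⟩⟩, ?_⟩
  have : sq B ⟨u, mem_sq_domain.2 ⟨u.2, hy⟩⟩ = f - ((l : 𝕜) ^ 2) • (u : H) := hBB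
  simp only [sqAdd, LinearMap.add_apply, LinearMap.smul_apply, Submodule.subtype_apply]
  change sq B _ + _ = f
  rw [this, sub_add_cancel]

theorem sqAdd_injective (hB : IsSelfAdjoint B) {l : ℝ} (hl : l ≠ 0) :
    Function.Injective (sqAdd B l) := by
  rw [injective_iff_map_eq_zero]
  intro u hu
  have h := norm_sqAdd hB l u
  rw [hu, norm_zero] at h
  have h4 : 0 < l ^ 4 := by positivity
  have : l ^ 4 * ‖(u : H)‖ ^ 2 = 0 := by
    have a1 : 0 ≤ ‖sq B u‖ ^ 2 := by positivity
    have a2 : 0 ≤ 2 * l ^ 2 * ‖B ⟨u, sq_domain_le B u.2⟩‖ ^ 2 := by positivity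
    have a3 : 0 ≤ l ^ 4 * ‖(u : H)‖ ^ 2 := by positivity
    nlinarith
  have : ‖(u : H)‖ = 0 := by simpa [h4.ne', hl] using this
  exact Subtype.ext (norm_eq_zero.1 this)

/-- `R₀(l) = (B² + l²)⁻¹`, as a linear map onto the domain of `B²`. -/
def R0 (hB : IsSelfAdjoint B) {l : ℝ} (hl : l ≠ 0) : H →ₗ[𝕜] (sq B).domain :=
  (LinearEquiv.ofBijective (sqAdd B l)
    ⟨sqAdd_injective hB hl, sqAdd_surjective hB hl⟩).symm.toLinearMap

theorem sqAdd_R0 (hB : IsSelfAdjoint B) {l : ℝ} (hl : l ≠ 0) (f : H) :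
    sqAdd B l (R0 hB hl f) = f :=
  (LinearEquiv.ofBijective (sqAdd B l)
    ⟨sqAdd_injective hB hl, sqAdd_surjective hB hl⟩).apply_symm_apply f

theorem norm_H1_sq (x : H1 B) : ‖x‖ ^ 2 = ‖B (x : B.domain)‖ ^ 2 + ‖(x : B.domain).1‖ ^ 2 :=
  WithLp.prod_norm_sq_eq_of_L2 (GraphDom.emb B x)

theorem norm_H2_sq (x : H2 B) :
    ‖x‖ ^ 2 = ‖sq B (x : (sq B).domain)‖ ^ 2 + ‖(x : (sq B).domain).1‖ ^ 2 :=
  WithLp.prod_norm_sq_eq_of_L2 (GraphDom.emb (sq B) x)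

theorem norm_toHbar2_sq (x : (sq B).domain) :
    ‖toHbar2 B x‖ ^ 2 = ‖sq B x‖ ^ 2 + ‖B ⟨x, sq_domain_le B x.2⟩‖ ^ 2 := by
  have h : Hbar2.emb B (toHbar2 B x) =
      (⟨B ⟨x, sq_domain_le B x.2⟩, (mem_sq_domain.1 x.2).2⟩ : B.domain) :=
    Subtype.ext (Bbar_coe B _)
  change ‖Hbar2.emb B (toHbar2 B x)‖ ^ 2 = _
  rw [h]
  exact norm_H1_sq _

theorem norm_B_sq_le (hB : IsSelfAdjoint B) (u : (sq B).domain) :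
    ‖B ⟨u, sq_domain_le B u.2⟩‖ ^ 2 ≤ ‖sq B u‖ ^ 2 + ‖(u : H)‖ ^ 2 := by
  have h2 : inner 𝕜 (sq B u) (u : H) =
      inner 𝕜 (B ⟨u, sq_domain_le B u.2⟩) (B ⟨u, sq_domain_le B u.2⟩) :=
    symm_of_sa hB ⟨B ⟨u, sq_domain_le B u.2⟩, (mem_sq_domain.1 u.2).2⟩ ⟨u, sq_domain_le B u.2⟩
  have h3 := re_inner_le_norm (𝕜 := 𝕜) (sq B u) (u : H)
  rw [h2, inner_self_eq_norm_sq] at h3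
  nlinarith [sq_nonneg (‖sq B u‖ - ‖(u : H)‖), sq_nonneg (‖sq B u‖ + ‖(u : H)‖)]

/-- The inclusion of `H₂` in `H₁`. -/
def H2toH1 (hB : IsSelfAdjoint B) : H2 B →L[𝕜] H1 B :=
  LinearMap.mkContinuous (σ := RingHom.id 𝕜)
    (show H2 B →ₗ[𝕜] H1 B from Submodule.inclusion (sq_domain_le B)) 2 fun x => by
    refine le_of_sq_le_sq ?_ (by positivity)
    rw [norm_H1_sq, mul_pow, norm_H2_sq]
    have := norm_B_sq_le hB x
    change ‖B ⟨(show (sq B).domain from x).1, _⟩‖ ^ 2 + ‖(show (sq B).domain from x).1‖ ^ 2 ≤ _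
    nlinarith [sq_nonneg ‖sq B (x : (sq B).domain)‖, sq_nonneg ‖(x : (sq B).domain).1‖]

/-- The inclusion of `H₂` in `H̄₂`. -/
def H2toHbar2 (hB : IsSelfAdjoint B) : H2 B →L[𝕜] Hbar2 B :=
  LinearMap.mkContinuous (σ := RingHom.id 𝕜)
    (show H2 B →ₗ[𝕜] Hbar2 B from toHbar2 B) 2 fun x => by
    refine le_of_sq_le_sq ?_ (by positivity)
    have := norm_B_sq_le hB x
    have h2 := norm_toHbar2_sq (B := B) x
    rw [mul_pow, norm_H2_sq]
    change ‖toHbar2 B x‖ ^ 2 ≤ _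
    rw [h2]
    nlinarith [sq_nonneg ‖sq B (x : (sq B).domain)‖, sq_nonneg ‖(x : (sq B).domain).1‖]

/-- `R₀(l)` as a bounded operator from `H` to `H₂`. -/
def R0L (hB : IsSelfAdjoint B) {l : ℝ} (hl : l ≠ 0) : H →L[𝕜] H2 B :=
  LinearMap.mkContinuous (σ := RingHom.id 𝕜)
    (show H →ₗ[𝕜] H2 B from R0 hB hl) (1 + (l ^ 2)⁻¹) fun f => by
    refine le_of_sq_le_sq ?_ (by positivity)
    have h := norm_sqAdd hB l (R0 hB hl f)
    rw [sqAdd_R0] at h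
    rw [norm_H2_sq]
    change ‖sq B (R0 hB hl f)‖ ^ 2 + ‖(R0 hB hl f).1‖ ^ 2 ≤ _
    rw [mul_pow, h]
    have hk : 0 < (l ^ 2)⁻¹ := by positivity
    have hk2 : ((l ^ 2)⁻¹) ^ 2 * l ^ 4 = 1 := by field_simp
    have a1 : 0 ≤ ‖sq B (R0 hB hl f)‖ ^ 2 := by positivity
    have a2 : 0 ≤ 2 * l ^ 2 * ‖B ⟨R0 hB hl f, sq_domain_le B (R0 hB hl f).2⟩‖ ^ 2 := by positivity
    have a3 : 0 ≤ l ^ 4 * ‖(R0 hB hl f).1‖ ^ 2 := by positivity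
    generalize (l ^ 2)⁻¹ = k at *
    have a4 : ‖(R0 hB hl f).1‖ ^ 2 = k ^ 2 * (l ^ 4 * ‖(R0 hB hl f).1‖ ^ 2) := by
      rw [← mul_assoc, hk2, one_mul]
    generalize l ^ 4 * ‖(R0 hB hl f).1‖ ^ 2 = c at *
    generalize 2 * l ^ 2 * ‖B ⟨R0 hB hl f, sq_domain_le B (R0 hB hl f).2⟩‖ ^ 2 = b at *
    generalize ‖sq B (R0 hB hl f)‖ ^ 2 = a at *
    rw [a4]
    have : 0 ≤ (2 * k + k ^ 2) * a := by positivity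
    have : 0 ≤ (1 + k) ^ 2 * b := by positivity
    have : 0 ≤ (1 + 2 * k) * c := by positivity
    nlinarith

theorem completeSpace_Hbar2 (hB : IsSelfAdjoint B) : CompleteSpace (Hbar2 B) := by
  let f : Hbar2 B →ₗ[𝕜] WithLp 2 (H × Hbar1 B) :=
    (WithLp.linearEquiv 2 𝕜 (H × Hbar1 B)).symm.toLinearMap ∘ₗ
      (B.toFun ∘ₗ Hbar2.emb B).prod (Hbar2.incl B)
  have hf : Isometry f := AddMonoidHomClass.isometry_of_norm f fun φ => by
    have h1 : ‖φ‖ ^ 2 = _ := norm_H1_sq (Hbar2.emb B φ)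
    have h2 := WithLp.prod_norm_sq_eq_of_L2 (f φ)
    have h3 : ‖Bbar B (Hbar2.incl B φ)‖ = _ := norm_Bbar B (Hbar2.incl B φ)
    have h4 : ‖f φ‖ ^ 2 = ‖φ‖ ^ 2 := by
      rw [h1, h2]
      change ‖B (Hbar2.emb B φ)‖ ^ 2 + ‖Hbar2.incl B φ‖ ^ 2 =
        ‖B (Hbar2.emb B φ)‖ ^ 2 + ‖Bbar B (Hbar2.incl B φ)‖ ^ 2
      rw [h3]
    exact (sq_eq_sq₀ (norm_nonneg _) (norm_nonneg _)).1 h4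
  rw [completeSpace_iff_isComplete_range hf.isUniformInducing]
  let q : WithLp 2 (H × Hbar1 B) → H × H := fun z => (Bbar B z.snd, z.fst)
  have hq : Continuous q := by fun_prop
  have hr : Set.range f = q ⁻¹' (B.graph : Set (H × H)) := by
    ext z
    constructor
    · rintro ⟨φ, rfl⟩
      exact B.mem_graph (Hbar2.emb B φ)
    · intro hz
      obtain ⟨y, hy, hy'⟩ := LinearPMap.mem_graph_iff _ |>.1 hz
      have hy1 : (y : H) = Bbar B z.snd := hy
      have hm : Bbar B z.snd ∈ B.domain := hy1 ▸ y.2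
      refine ⟨(⟨z.snd, hm⟩ : hbar2 B), ?_⟩
      have e : y = ⟨Bbar B z.snd, hm⟩ := Subtype.ext hy1
      have : B ⟨Bbar B z.snd, hm⟩ = z.fst := e ▸ hy'
      exact (WithLp.ofLp_injective 2) (Prod.ext this rfl)
  rw [hr]
  exact (IsClosed.preimage hq hB.isClosed).isComplete

theorem R0_mem (hB : IsSelfAdjoint B) {l : ℝ} (hl : l ≠ 0) (x : B.domain) :
    ∃ hv : B ⟨R0 hB hl (x : H), sq_domain_le B (R0 hB hl (x : H)).2⟩ ∈ (sq B).domain,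
      sqAdd B l ⟨B ⟨R0 hB hl (x : H), sq_domain_le B (R0 hB hl (x : H)).2⟩, hv⟩ = B x := by
  have h := sqAdd_R0 hB hl (x : H)
  set u := R0 hB hl (x : H)
  have h' : sq B u + ((l : 𝕜) ^ 2) • (u : H) = x := h
  have hs : sq B u = ((x - ((l : 𝕜) ^ 2) • (⟨u, sq_domain_le B u.2⟩ : B.domain) : B.domain) : H) :=
    eq_sub_of_add_eq h'
  have hv : B ⟨u, sq_domain_le B u.2⟩ ∈ (sq B).domain :=
    mem_sq_domain.2 ⟨(mem_sq_domain.1 u.2).2, by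
      change sq B u ∈ B.domain
      rw [hs]; exact Subtype.property _⟩
  refine ⟨hv, ?_⟩
  change B ⟨sq B u, _⟩ + ((l : 𝕜) ^ 2) • B ⟨u, sq_domain_le B u.2⟩ = B x
  have e : (⟨sq B u, hs ▸ Subtype.property _⟩ : B.domain) =
      x - ((l : 𝕜) ^ 2) • (⟨u, sq_domain_le B u.2⟩ : B.domain) := Subtype.ext hs
  rw [e, B.map_sub, B.map_smul, sub_add_cancel]

theorem R0E_bound {l : ℝ} (hl : l ≠ 0) {a b c : ℝ} (ha : 0 ≤ a) (hb : 0 ≤ b) (hc : 0 ≤ c) :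
    a + b ≤ ((l ^ 2)⁻¹ + |l|⁻¹) ^ 2 * (c + 2 * l ^ 2 * a + l ^ 4 * b) := by
  have hl' : 0 < |l| := abs_pos.2 hl
  have e2 : l ^ 2 = |l| ^ 2 := (sq_abs l).symm
  have e4 : l ^ 4 = |l| ^ 4 := by rw [show l ^ 4 = (l ^ 2) ^ 2 by ring, e2]; ring
  rw [e2, e4]
  generalize |l| = k at *
  have h1 : ((k ^ 2)⁻¹ + k⁻¹) ^ 2 * (c + 2 * k ^ 2 * a + k ^ 4 * b)
      = a + b + (((k ^ 2)⁻¹ + k⁻¹) ^ 2 * c + (2 * (k⁻¹ + 1) ^ 2 - 1) * a + (2 * k + k ^ 2) * b) := by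
    field_simp
    ring
  have h2 : 0 ≤ 2 * (k⁻¹ + 1) ^ 2 - 1 := by
    have : 0 < k⁻¹ := by positivity
    nlinarith
  rw [h1]
  have : 0 ≤ ((k ^ 2)⁻¹ + k⁻¹) ^ 2 * c + (2 * (k⁻¹ + 1) ^ 2 - 1) * a + (2 * k + k ^ 2) * b := by
    positivity
  linarith

/-- `R₀(l)` on the domain of `B`, as a bounded operator from the norm of `H̄₁` to `H̄₂`. -/
def R0E (hB : IsSelfAdjoint B) {l : ℝ} (hl : l ≠ 0) : EnergyDom B →L[𝕜] Hbar2 B :=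
  LinearMap.mkContinuous (σ := RingHom.id 𝕜)
    (show EnergyDom B →ₗ[𝕜] Hbar2 B from toHbar2 B ∘ₗ R0 hB hl ∘ₗ B.domain.subtype)
    ((l ^ 2)⁻¹ + |l|⁻¹) fun x => by
    refine le_of_sq_le_sq ?_ (by positivity)
    obtain ⟨hv, h⟩ := R0_mem hB hl x
    have hn := norm_sqAdd hB l ⟨_, hv⟩
    rw [h] at hn
    change ‖toHbar2 B (R0 hB hl (show B.domain from x).1)‖ ^ 2 ≤ _
    rw [norm_toHbar2_sq, mul_pow]
    have hx : ‖x‖ ^ 2 = _ := hn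
    rw [hx]
    exact R0E_bound hl (sq_nonneg _) (sq_nonneg _) (sq_nonneg _)

/-- `R̄₀(l) : H̄₁ → H̄₂`: the bounded extension of `R₀(l)`. -/
def R0bar (hB : IsSelfAdjoint B) {l : ℝ} (hl : l ≠ 0) : Hbar1 B →L[𝕜] Hbar2 B :=
  haveI := completeSpace_Hbar2 hB
  (R0E hB hl).extend UniformSpace.Completion.toComplL

end Resolvent

/-! ### Singular perturbations -/

section Perturbation

variable {𝕜 H h V : Type*} [RCLike 𝕜]
variable [NormedAddCommGroup H] [InnerProductSpace 𝕜 H] [CompleteSpace H]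
variable [NormedAddCommGroup h] [InnerProductSpace 𝕜 h] [CompleteSpace h]
variable [AddCommGroup V] [Module 𝕜 V]
variable {B : H →ₗ.[𝕜] H}

/-- `W(φ, ψ) = (ψ, Ā φ)` on `H̄₁ ⊕ H`, with domain `H̄₂ ⊕ H₁`. -/
def W (B : H →ₗ.[𝕜] H) : WithLp 2 (Hbar1 B × H) →ₗ.[𝕜] WithLp 2 (Hbar1 B × H) where
  domain := ((hbar2 B).prod B.domain).comap (WithLp.linearEquiv 2 𝕜 (Hbar1 B × H)).toLinearMap
  toFun :=
    { toFun := fun x => WithLp.toLp 2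
        (toHbar1 B ⟨x.1.snd, x.2.2⟩, Abar B (Hbar2.mk x.1.fst x.2.1))
      map_add' := fun x y => congrArg (WithLp.toLp 2) <| Prod.ext
        ((toHbar1 B).map_add ⟨x.1.snd, x.2.2⟩ ⟨y.1.snd, y.2.2⟩)
        ((Abar B).map_add (Hbar2.mk x.1.fst x.2.1) (Hbar2.mk y.1.fst y.2.1))
      map_smul' := fun c x => congrArg (WithLp.toLp 2) <| Prod.ext
        ((toHbar1 B).map_smul c ⟨x.1.snd, x.2.2⟩)
        ((Abar B).map_smul c (Hbar2.mk x.1.fst x.2.1)) }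

theorem eq_zero_of_inner_eq_zero {Θ : h →L[𝕜] h} (hΘ : Θ.IsPositive) {z : h}
    (hz : inner 𝕜 (Θ z) z = 0) : Θ z = 0 := by
  set w := Θ z with hw
  have hsym : inner 𝕜 (Θ w) z = inner 𝕜 w w := hΘ.isSymmetric w z
  have hc := hΘ.re_inner_nonneg_left w
  have key : ∀ t : ℝ, 0 ≤ 2 * t * ‖w‖ ^ 2 + t ^ 2 * RCLike.re (inner 𝕜 (Θ w) w) := by
    intro t
    have h1 := hΘ.re_inner_nonneg_left (z + (t : 𝕜) • w)
    have h2 : inner 𝕜 (Θ (z + (t : 𝕜) • w)) (z + (t : 𝕜) • w) =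
        ((2 * t : ℝ) : 𝕜) * inner 𝕜 w w + ((t ^ 2 : ℝ) : 𝕜) * inner 𝕜 (Θ w) w := by
      rw [map_add, map_smul, ← hw]
      simp only [inner_add_left, inner_add_right, inner_smul_left, inner_smul_right, hz, hsym,
        RCLike.conj_ofReal]
      push_cast
      ring
    rw [h2, map_add, RCLike.re_ofReal_mul, RCLike.re_ofReal_mul, inner_self_eq_norm_sq] at h1
    exact h1
  generalize RCLike.re (inner 𝕜 (Θ w) w) = c at *
  have h3 := key (-(‖w‖ ^ 2) / (c + 1))
  have h4 : 2 * (-(‖w‖ ^ 2) / (c + 1)) * ‖w‖ ^ 2 + (-(‖w‖ ^ 2) / (c + 1)) ^ 2 * c =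
      -((‖w‖ ^ 2 / (c + 1)) ^ 2 * (c + 2)) := by
    field_simp
    ring
  rw [h4] at h3
  have h5 : (‖w‖ ^ 2 / (c + 1)) ^ 2 = 0 := by
    have : 0 ≤ (‖w‖ ^ 2 / (c + 1)) ^ 2 := by positivity
    nlinarith
  have h6 : ‖w‖ ^ 2 / (c + 1) = 0 := by simpa using h5
  rw [div_eq_zero_iff] at h6
  rcases h6 with h6 | h6
  · simpa using h6
  · linarith

/-- The space `h` with the inner product `⟪Θ ζ, η⟫`. -/
def HTheta (Θ : h →L[𝕜] h) (_ : Θ.IsPositive) (_ : Function.Injective Θ) : Type _ := h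

section HTheta

variable (Θ : h →L[𝕜] h) (hΘ : Θ.IsPositive) (hΘi : Function.Injective Θ)

instance : AddCommGroup (HTheta Θ hΘ hΘi) := inferInstanceAs (AddCommGroup h)
instance : Module 𝕜 (HTheta Θ hΘ hΘi) := inferInstanceAs (Module 𝕜 h)

/-- The identity from `h_Θ` to `h`. -/
def HTheta.val : HTheta Θ hΘ hΘi ≃ₗ[𝕜] h := LinearEquiv.refl 𝕜 h

/-- The inner product `⟪Θ ζ, η⟫`. -/
@[reducible]
def HTheta.core : InnerProductSpace.Core 𝕜 (HTheta Θ hΘ hΘi) where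
  inner ζ η := inner 𝕜 (Θ (HTheta.val Θ hΘ hΘi ζ)) (HTheta.val Θ hΘ hΘi η)
  conj_inner_symm ζ η := by
    rw [inner_conj_symm]
    exact (hΘ.isSymmetric _ _).symm
  re_inner_nonneg ζ := hΘ.re_inner_nonneg_left _
  add_left ζ η ξ := by
    simp only [map_add, inner_add_left]
  smul_left ζ η c := by
    simp only [map_smul, inner_smul_left]
  definite ζ hζ := by
    have hz : inner 𝕜 (Θ (HTheta.val Θ hΘ hΘi ζ)) (HTheta.val Θ hΘ hΘi ζ) = 0 := hζ
    have hs := eq_zero_of_inner_eq_zero hΘ hz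
    exact (HTheta.val Θ hΘ hΘi).injective (hΘi (by rw [hs, map_zero, map_zero]))

instance : NormedAddCommGroup (HTheta Θ hΘ hΘi) := (HTheta.core Θ hΘ hΘi).toNormedAddCommGroup
instance : InnerProductSpace 𝕜 (HTheta Θ hΘ hΘi) :=
  InnerProductSpace.ofCore (HTheta.core Θ hΘ hΘi).toCore

end HTheta

/-- `τ_Θ(φ, ψ, ζ) = τ φ - Θ ζ`. -/
def tauTheta (τ : Hbar2 B →L[𝕜] h) (Θ : h →L[𝕜] h) : Hbar2 B × H × h →ₗ[𝕜] h :=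
  τ.toLinearMap ∘ₗ LinearMap.fst 𝕜 _ _ -
    Θ.toLinearMap ∘ₗ LinearMap.snd 𝕜 _ _ ∘ₗ LinearMap.snd 𝕜 _ _

/-- `τ* : h → H₋₂`, `τ* ζ = (φ ↦ ⟪ζ, τ φ⟫)`, where `H₋₂` is the dual of `H₂`. -/
def tauStar (hB : IsSelfAdjoint B) (τ : Hbar2 B →L[𝕜] h) (ζ : h) : StrongDual 𝕜 (H2 B) :=
  (innerSL 𝕜 ζ).comp (τ.comp (H2toHbar2 hB))

/-- `H₋₁`, the dual of `H₁`, as a subset of `H₋₂`, the dual of `H₂`. -/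
def HNegOne (hB : IsSelfAdjoint B) : Set (StrongDual 𝕜 (H2 B)) :=
  Set.range fun m : StrongDual 𝕜 (H1 B) => m.comp (H2toH1 hB)

/-- `G(l) = (τ R₀(l))*`. -/
def Gl (hB : IsSelfAdjoint B) (τ : Hbar2 B →L[𝕜] h) {l : ℝ} (hl : l ≠ 0) : h →L[𝕜] H :=
  (τ.comp ((H2toHbar2 hB).comp (R0L hB hl))).adjoint

/-- `Ḡ(l) = (τ R̄₀(l))*`. -/
def Gbar (hB : IsSelfAdjoint B) (τ : Hbar2 B →L[𝕜] h) {l : ℝ} (hl : l ≠ 0) : h →L[𝕜] Hbar1 B :=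
  (τ.comp (R0bar hB hl)).adjoint

/-- `H` and `H̄₁` are contained in the vector space `V`, by means of `i₀` and `i₁`: the two
inclusions agree on the domain of `B`, which is the intersection of `H` and `H̄₁`. -/
structure IsCommonSpace (B : H →ₗ.[𝕜] H) (i₀ : H →ₗ[𝕜] V) (i₁ : Hbar1 B →ₗ[𝕜] V) : Prop where
  inj₀ : Function.Injective i₀
  inj₁ : Function.Injective i₁
  compat : ∀ x : B.domain, i₀ x = i₁ (toHbar1 B x)
  inter : ∀ (x : H) (φ : Hbar1 B), i₀ x = i₁ φ → x ∈ B.domain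

/-- `G = G(l) + l² Ḡ(l) : h → V`. -/
def G (hB : IsSelfAdjoint B) (τ : Hbar2 B →L[𝕜] h) (i₀ : H →ₗ[𝕜] V) (i₁ : Hbar1 B →ₗ[𝕜] V)
    {l : ℝ} (hl : l ≠ 0) : h →ₗ[𝕜] V :=
  i₀ ∘ₗ (Gl hB τ hl).toLinearMap + ((l : 𝕜) ^ 2) • i₁ ∘ₗ (Gbar hB τ hl).toLinearMap

/-- The map `(φ₀, ζ) ↦ φ₀ + g ζ`. -/
def sumMap (i₁ : Hbar1 B →ₗ[𝕜] V) (g : h →ₗ[𝕜] V) : Hbar1 B × h →ₗ[𝕜] V := i₁.coprod g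

/-- `K̄₁`: the subspace of the vectors `φ₀ + g ζ` of `V`, with `φ₀` in `H̄₁` and `ζ` in `h`. -/
def Kbar1 (i₁ : Hbar1 B →ₗ[𝕜] V) (g : h →ₗ[𝕜] V) (Θ : h →L[𝕜] h) (_ : Θ.IsPositive)
    (_ : Function.Injective Θ) (_ : Function.Injective (sumMap i₁ g)) : Type _ :=
  LinearMap.range (sumMap i₁ g)

section Kbar1

variable (i₀ : H →ₗ[𝕜] V) (i₁ : Hbar1 B →ₗ[𝕜] V) (g : h →ₗ[𝕜] V) (Θ : h →L[𝕜] h)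
  (hΘ : Θ.IsPositive) (hΘi : Function.Injective Θ) (hU : Function.Injective (sumMap i₁ g))

instance : AddCommGroup (Kbar1 i₁ g Θ hΘ hΘi hU) :=
  inferInstanceAs (AddCommGroup (LinearMap.range (sumMap i₁ g)))
instance : Module 𝕜 (Kbar1 i₁ g Θ hΘ hΘi hU) :=
  inferInstanceAs (Module 𝕜 (LinearMap.range (sumMap i₁ g)))

/-- An element of `V` of the form `φ₀ + g ζ`, as an element of `K̄₁`. -/
def Kbar1.mk (φ : V) (hφ : φ ∈ LinearMap.range (sumMap i₁ g)) : Kbar1 i₁ g Θ hΘ hΘi hU :=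
  (⟨φ, hφ⟩ : LinearMap.range (sumMap i₁ g))

/-- The identification of `H̄₁ × h` with `K̄₁`. -/
def Kbar1.equiv : (Hbar1 B × h) ≃ₗ[𝕜] Kbar1 i₁ g Θ hΘ hΘi hU := LinearEquiv.ofInjective _ hU

/-- The component `φ₀` of `φ = φ₀ + g ζ`. -/
def Kbar1.reg : Kbar1 i₁ g Θ hΘ hΘi hU →ₗ[𝕜] Hbar1 B :=
  LinearMap.fst 𝕜 _ _ ∘ₗ (Kbar1.equiv i₁ g Θ hΘ hΘi hU).symm.toLinearMap

/-- The component `ζ` of `φ = φ₀ + g ζ`. -/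
def Kbar1.charge : Kbar1 i₁ g Θ hΘ hΘi hU →ₗ[𝕜] h :=
  LinearMap.snd 𝕜 _ _ ∘ₗ (Kbar1.equiv i₁ g Θ hΘ hΘi hU).symm.toLinearMap

/-- `φ₀ + g ζ ↦ (φ₀, ζ)`, with values in `H̄₁ ⊕ h_Θ`. -/
def Kbar1.emb : Kbar1 i₁ g Θ hΘ hΘi hU →ₗ[𝕜] WithLp 2 (Hbar1 B × HTheta Θ hΘ hΘi) :=
  (WithLp.linearEquiv 2 𝕜 (Hbar1 B × HTheta Θ hΘ hΘi)).symm.toLinearMap ∘ₗ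
    (Kbar1.equiv i₁ g Θ hΘ hΘi hU).symm.toLinearMap

/-- The norm of the inner product `⟪B̄ φ₀, B̄ φ₀'⟫ + ⟪Θ ζ, ζ'⟫`. -/
instance : NormedAddCommGroup (Kbar1 i₁ g Θ hΘ hΘi hU) :=
  NormedAddCommGroup.induced _ _ (Kbar1.emb i₁ g Θ hΘ hΘi hU) <|
    (WithLp.linearEquiv 2 𝕜 (Hbar1 B × HTheta Θ hΘ hΘi)).symm.injective.comp
      (Kbar1.equiv i₁ g Θ hΘ hΘi hU).symm.injective
instance : InnerProductSpace 𝕜 (Kbar1 i₁ g Θ hΘ hΘi hU) :=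
  InnerProductSpace.induced (Kbar1.emb i₁ g Θ hΘ hΘi hU)

/-- `K̄₁ ⊕ H`. -/
abbrev KTot : Type _ := WithLp 2 (Kbar1 i₁ g Θ hΘ hΘi hU × H)

/-- `H̄₁ ⊕ H ⊕ h_Θ`. -/
abbrev HTot (B : H →ₗ.[𝕜] H) (Θ : h →L[𝕜] h) (hΘ : Θ.IsPositive) (hΘi : Function.Injective Θ) :
    Type _ := WithLp 2 (Hbar1 B × WithLp 2 (H × HTheta Θ hΘ hΘi))

/-- The inclusion of `H̄₁ ⊕ H` in `K̄₁ ⊕ H`. -/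
def incl : WithLp 2 (Hbar1 B × H) →ₗ[𝕜] KTot i₁ g Θ hΘ hΘi hU :=
  (WithLp.linearEquiv 2 𝕜 (Kbar1 i₁ g Θ hΘ hΘi hU × H)).symm.toLinearMap ∘ₗ
    (((Kbar1.equiv i₁ g Θ hΘ hΘi hU).toLinearMap ∘ₗ LinearMap.inl 𝕜 (Hbar1 B) h).prodMap
      LinearMap.id) ∘ₗ (WithLp.linearEquiv 2 𝕜 (Hbar1 B × H)).toLinearMap

/-- The vectors `(φ, ψ)` of `K̄₂ ⊕ K₁` with `Θ ζ = τ φ₀`, where `φ = φ₀ + g ζ`. Here `φ` is in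
`K̄₂` if `φ₀` is in `H̄₂`, and `K₁` is the intersection of `K̄₁` and `H` in `V`. -/
def WThetaDomain (τ : Hbar2 B →L[𝕜] h) : Submodule 𝕜 (KTot i₁ g Θ hΘ hΘi hU) where
  carrier := {x | (∃ φ₀ : Hbar2 B, Hbar2.incl B φ₀ = Kbar1.reg i₁ g Θ hΘ hΘi hU x.fst ∧
      Θ (Kbar1.charge i₁ g Θ hΘ hΘi hU x.fst) = τ φ₀) ∧
    i₀ x.snd ∈ LinearMap.range (sumMap i₁ g)}
  zero_mem' := ⟨⟨0, by simp⟩, by simp⟩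
  add_mem' := by
    rintro x y ⟨⟨φ, h1, h2⟩, h3⟩ ⟨⟨φ', h1', h2'⟩, h3'⟩
    exact ⟨⟨φ + φ', by simp [h1, h1'], by simp [h2, h2']⟩, by
      rw [WithLp.add_snd, map_add]; exact add_mem h3 h3'⟩
  smul_mem' := by
    rintro c x ⟨⟨φ, h1, h2⟩, h3⟩
    exact ⟨⟨c • φ, by simp [h1], by simp [h2]⟩, by
      rw [WithLp.smul_snd, map_smul]; exact Submodule.smul_mem _ c h3⟩

theorem mem_hbar2_of_mem {τ : Hbar2 B →L[𝕜] h} {x : KTot i₁ g Θ hΘ hΘi hU}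
    (hx : x ∈ WThetaDomain i₀ i₁ g Θ hΘ hΘi hU τ) :
    Kbar1.reg i₁ g Θ hΘ hΘi hU x.fst ∈ hbar2 B := by
  obtain ⟨⟨φ, h1, -⟩, -⟩ := hx
  exact h1 ▸ φ.2

/-- `W_Θ(φ, ψ) = (ψ, Ā φ₀)`. -/
def WTheta (τ : Hbar2 B →L[𝕜] h) :
    KTot i₁ g Θ hΘ hΘi hU →ₗ.[𝕜] KTot i₁ g Θ hΘ hΘi hU where
  domain := WThetaDomain i₀ i₁ g Θ hΘ hΘi hU τ
  toFun :=
    { toFun := fun x => WithLp.toLp 2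
        (Kbar1.mk i₁ g Θ hΘ hΘi hU (i₀ x.1.snd) x.2.2,
          Abar B (Hbar2.mk (Kbar1.reg i₁ g Θ hΘ hΘi hU x.1.fst)
            (mem_hbar2_of_mem i₀ i₁ g Θ hΘ hΘi hU x.2)))
      map_add' := fun x y => congrArg (WithLp.toLp 2) <| Prod.ext
        (Subtype.ext (i₀.map_add x.1.snd y.1.snd))
        ((congrArg (Abar B) <| Subtype.ext <|
          (Kbar1.reg i₁ g Θ hΘ hΘi hU).map_add x.1.fst y.1.fst).trans ((Abar B).map_add
            (Hbar2.mk _ (mem_hbar2_of_mem i₀ i₁ g Θ hΘ hΘi hU x.2))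
            (Hbar2.mk _ (mem_hbar2_of_mem i₀ i₁ g Θ hΘ hΘi hU y.2))))
      map_smul' := fun c x => congrArg (WithLp.toLp 2) <| Prod.ext
        (Subtype.ext (i₀.map_smul c x.1.snd))
        ((congrArg (Abar B) <| Subtype.ext <|
          (Kbar1.reg i₁ g Θ hΘ hΘi hU).map_smul c x.1.fst).trans ((Abar B).map_smul c
            (Hbar2.mk _ (mem_hbar2_of_mem i₀ i₁ g Θ hΘ hΘi hU x.2)))) }

end Kbar1

/-- The graph of `W̃_Θ` on `H̄₁ ⊕ H ⊕ h_Θ`: the pairs `((φ₀, ψ, ζ), (ψ₀, Ā φ₀, ξ))` with `φ₀` in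
`H̄₂`, `Θ ζ = τ φ₀`, `ψ = ψ' + G(l) ξ` with `ψ'` in `H₁`, and `ψ₀ = ψ' - l² Ḡ(l) ξ`. -/
def WTildeGraph (hB : IsSelfAdjoint B) (τ : Hbar2 B →L[𝕜] h) (Θ : h →L[𝕜] h) (hΘ : Θ.IsPositive)
    (hΘi : Function.Injective Θ) {l : ℝ} (hl : l ≠ 0) :
    Submodule 𝕜 (HTot B Θ hΘ hΘi × HTot B Θ hΘ hΘi) where
  carrier := {p | ∃ (φ₀ : Hbar2 B) (ψ' : B.domain) (ζ ξ : h), Θ ζ = τ φ₀ ∧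
    p.1 = WithLp.toLp 2 (Hbar2.incl B φ₀, WithLp.toLp 2 ((ψ' : H) + Gl hB τ hl ξ,
      (HTheta.val Θ hΘ hΘi).symm ζ)) ∧
    p.2 = WithLp.toLp 2 (toHbar1 B ψ' - ((l : 𝕜) ^ 2) • Gbar hB τ hl ξ,
      WithLp.toLp 2 (Abar B φ₀, (HTheta.val Θ hΘ hΘi).symm ξ))}
  zero_mem' := ⟨0, 0, 0, 0, by simp, by simp; rfl, by simp; rfl⟩
  add_mem' := by
    rintro p q ⟨φ, ψ, ζ, ξ, h1, h2, h3⟩ ⟨φ', ψ', ζ', ξ', h1', h2', h3'⟩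
    refine ⟨φ + φ', ψ + ψ', ζ + ζ', ξ + ξ', by simp [h1, h1'], ?_, ?_⟩
    · rw [Prod.fst_add, h2, h2', ← WithLp.toLp_add, Prod.mk_add_mk, ← WithLp.toLp_add,
        Prod.mk_add_mk]
      simp only [map_add, Submodule.coe_add]
      congr 4
      abel
    · rw [Prod.snd_add, h3, h3', ← WithLp.toLp_add, Prod.mk_add_mk, ← WithLp.toLp_add,
        Prod.mk_add_mk]
      simp only [map_add, smul_add]
      congr 2
      abel
  smul_mem' := by
    rintro c p ⟨φ, ψ, ζ, ξ, h1, h2, h3⟩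
    refine ⟨c • φ, c • ψ, c • ζ, c • ξ, by simp [h1], ?_, ?_⟩
    · rw [Prod.smul_fst, h2, ← WithLp.toLp_smul, Prod.smul_mk, ← WithLp.toLp_smul, Prod.smul_mk]
      simp only [map_smul, Submodule.coe_smul, smul_add]
    · rw [Prod.smul_snd, h3, ← WithLp.toLp_smul, Prod.smul_mk, ← WithLp.toLp_smul, Prod.smul_mk]
      simp only [map_smul, smul_sub, smul_comm c]

/-- `W̃_Θ`. -/
def WTilde (hB : IsSelfAdjoint B) (τ : Hbar2 B →L[𝕜] h) (Θ : h →L[𝕜] h) (hΘ : Θ.IsPositive)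
    (hΘi : Function.Injective Θ) {l : ℝ} (hl : l ≠ 0) :
    HTot B Θ hΘ hΘi →ₗ.[𝕜] HTot B Θ hΘ hΘi :=
  (WTildeGraph hB τ Θ hΘ hΘi hl).toLinearPMap

end Perturbation

end AbstractWave

end

/-!
By Green's identity `⟪ζ, τ φ⟫ = -⟪G(λ) ζ, Ā φ⟫ + λ² ⟪Ḡ(λ) ζ, φ⟫`, the boundary condition
`Θ ζ = τ φ₀` makes the energy of the charges cancel the boundary term, so `W_Θ` is skew-symmetric;
it is then skew-adjoint as soon as it is densely defined and `±1 - W_Θ` is onto.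

Solving `(μ - W_Θ) x = y` amounts to solving the same equation for `W` and then an equation for the
charge alone, with the operator `Θ + μ² τ Ḡ(μ)`. This operator is coercive: by the open mapping
theorem (H3.0) bounds `‖ζ‖` by the two nonnegative terms of its quadratic form.

For the density of the domain, a functional that vanishes on `{(φ, ζ) | τ φ = Θ ζ}` factors as
`f ∘ (τ - Θ)` by (H3.0). Its restriction `f ∘ τ` to `ζ = 0` is then continuous for the norm of
`H̄₁`, so that (H3.1) forces `f = 0`. When `τ` is onto, the same argument shows that `Ker τ` is
dense in `H̄₁`.
-/

noncomputable section

namespace AbstractWave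

section Density

variable {𝕜 E X Y Z : Type*} [RCLike 𝕜]
variable [NormedAddCommGroup E] [NormedSpace 𝕜 E] [NormedAddCommGroup X] [NormedSpace 𝕜 X]
variable [NormedAddCommGroup Y] [NormedSpace 𝕜 Y] [NormedAddCommGroup Z] [NormedSpace 𝕜 Z]

theorem dense_of_forall_dual_eq_zero (p : Submodule 𝕜 E)
    (hp : ∀ f : StrongDual 𝕜 E, (∀ x ∈ p, f x = 0) → f = 0) : Dense (p : Set E) := by
  rw [Submodule.dense_iff_topologicalClosure_eq_top, eq_top_iff]
  intro x _
  have : IsClosed (p.topologicalClosure : Set E) := p.isClosed_topologicalClosure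
  rw [← Submodule.Quotient.mk_eq_zero]
  refine SeparatingDual.eq_zero_of_forall_dual_eq_zero (R := 𝕜) fun g => ?_
  have hg := hp (g.comp p.topologicalClosure.mkQL) fun y hy => by
    have hy' := (Submodule.Quotient.mk_eq_zero _).2 (p.le_topologicalClosure hy)
    exact (congrArg g hy').trans (map_zero g)
  exact DFunLike.congr_fun hg x

theorem exists_comp_eq_of_ker_le [CompleteSpace X] [CompleteSpace Y] {S : X →L[𝕜] Y}
    (hS : Function.Surjective S) {F : X →L[𝕜] Z} (hF : S.ker ≤ F.ker) :
    ∃ f : Y →L[𝕜] Z, f.comp S = F := by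
  obtain ⟨r, hr⟩ := S.toLinearMap.exists_rightInverse_of_surjective (LinearMap.range_eq_top.2 hS)
  have hFr : ∀ x, F (r (S x)) = F x := fun x => by
    rw [← sub_eq_zero, ← map_sub]
    refine hF (LinearMap.mem_ker.2 ?_)
    rw [map_sub, sub_eq_zero]
    exact LinearMap.congr_fun hr (S x)
  have hc : Continuous (F.toLinearMap ∘ₗ r) := by
    rw [((S.isOpenMap hS).isQuotientMap S.continuous hS).continuous_iff]
    exact F.continuous.congr fun x => (hFr x).symm
  exact ⟨⟨F.toLinearMap ∘ₗ r, hc⟩, ContinuousLinearMap.ext hFr⟩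

theorem dense_image_ker [CompleteSpace X] [CompleteSpace Y] {S : X →L[𝕜] Y}
    (hS : Function.Surjective S) {j : X →L[𝕜] E} (hj : DenseRange j)
    (h : ∀ (f : StrongDual 𝕜 Y) (F : StrongDual 𝕜 E), f.comp S = F.comp j → f = 0) :
    Dense (j '' {x | S x = 0}) := by
  refine dense_of_forall_dual_eq_zero (S.ker.map j.toLinearMap) fun F hF => ?_
  have hle : S.ker ≤ (F.comp j).ker := fun x hx => hF _ ⟨x, hx, rfl⟩
  obtain ⟨f, hf⟩ := exists_comp_eq_of_ker_le hS hle
  rw [h f F hf, ContinuousLinearMap.zero_comp] at hf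
  exact DFunLike.coe_injective <|
    hj.equalizer F.continuous continuous_const (congrArg DFunLike.coe hf.symm)

end Density

section Operators

variable {𝕜 E : Type*} [RCLike 𝕜] [NormedAddCommGroup E] [InnerProductSpace 𝕜 E]

theorem isSkewAdjoint_of_surjective {T : E →ₗ.[𝕜] E} (hd : Dense (T.domain : Set E))
    (hT : ∀ x y : T.domain, ⟪T x, (y : E)⟫_𝕜 = -⟪(x : E), T y⟫_𝕜) {c : 𝕜}
    (h₁ : Function.Surjective fun x : T.domain => c • (x : E) - T x)
    (h₂ : Function.Surjective fun x : T.domain => -(starRingEnd 𝕜) c • (x : E) - T x) :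
    IsSkewAdjoint T := by
  refine ⟨hd, ?_⟩
  ext ⟨x, y⟩
  rw [Submodule.mem_adjoint_iff, LinearPMap.mem_graph_iff]
  constructor
  · intro hxy
    obtain ⟨w, hw⟩ := h₁ (c • x + y)
    have hy : y = c • (w : E) - T w - c • x := eq_sub_of_add_eq' hw.symm
    have hx : x = w := by
      obtain ⟨z, hz⟩ := h₂ (x - w)
      have hzx : ⟪T z, x⟫_𝕜 - ⟪(z : E), y⟫_𝕜 = 0 := hxy z (T z) (T.mem_graph z)
      rw [← sub_eq_zero, ← inner_self_eq_zero (𝕜 := 𝕜)]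
      nth_rewrite 1 [← hz]
      simp only [hy, inner_sub_right, inner_smul_right] at hzx
      simp only [inner_sub_left, inner_sub_right, inner_smul_left, map_neg, RCLike.conj_conj]
      linear_combination hT z w - hzx
    subst hx
    exact ⟨w, rfl, (hy.trans (sub_sub_cancel_left _ _)).symm⟩
  · rintro ⟨w, rfl, rfl⟩ a b hab
    obtain ⟨z, rfl, rfl⟩ := (LinearPMap.mem_graph_iff _).1 hab
    rw [LinearPMap.neg_apply, inner_neg_right, hT z w]
    ring

theorem norm_apply_sq_le_of_isPositive {P : E →L[𝕜] E} (hP : P.IsPositive) (x : E) :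
    ‖P x‖ ^ 2 ≤ ‖P‖ * RCLike.re ⟪P x, x⟫_𝕜 := by
  let core : PreInnerProductSpace.Core 𝕜 E :=
    { inner := fun x y => ⟪P x, y⟫_𝕜
      conj_inner_symm := fun x y => by rw [inner_conj_symm]; exact (hP.isSymmetric x y).symm
      re_inner_nonneg := hP.re_inner_nonneg_left
      add_left := fun x y z => by rw [map_add, inner_add_left]
      smul_left := fun x y r => by rw [map_smul, inner_smul_left] }
  have hCS : ‖⟪P x, P x⟫_𝕜‖ * ‖⟪P (P x), x⟫_𝕜‖
      ≤ RCLike.re ⟪P x, x⟫_𝕜 * RCLike.re ⟪P (P x), P x⟫_𝕜 :=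
    InnerProductSpace.Core.inner_mul_inner_self_le (c := core) x (P x)
  have hPx : RCLike.re ⟪P (P x), P x⟫_𝕜 ≤ ‖P‖ * ‖P x‖ ^ 2 :=
    (re_inner_le_norm _ _).trans <| by nlinarith [P.le_opNorm (P x), norm_nonneg (P x)]
  rw [show ⟪P (P x), x⟫_𝕜 = ⟪P x, P x⟫_𝕜 from hP.isSymmetric (P x) x,
    inner_self_eq_norm_sq_to_K, norm_pow, RCLike.norm_ofReal, abs_norm] at hCS
  have h0 := hP.re_inner_nonneg_left x
  rcases (sq_nonneg ‖P x‖).eq_or_lt' with hz | hz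
  · rw [hz]
    positivity
  · refine le_of_mul_le_mul_right (hCS.trans ?_) hz
    calc _ ≤ RCLike.re ⟪P x, x⟫_𝕜 * (‖P‖ * ‖P x‖ ^ 2) := by gcongr
      _ = _ := by ring

end Operators

section Energy

variable {𝕜 H : Type*} [RCLike 𝕜] [NormedAddCommGroup H] [InnerProductSpace 𝕜 H] [CompleteSpace H]
variable {B : H →ₗ.[𝕜] H}

theorem inner_Hbar1 (φ ψ : Hbar1 B) : ⟪φ, ψ⟫_𝕜 = ⟪Bbar B φ, Bbar B ψ⟫_𝕜 :=
  ((LinearIsometry.mk (Bbar B).toLinearMap (norm_Bbar B)).inner_map_map φ ψ).symm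

theorem Bbar_injective (B : H →ₗ.[𝕜] H) : Function.Injective (Bbar B) :=
  (AddMonoidHomClass.isometry_of_norm _ (norm_Bbar B)).injective

theorem Bbar_surjective (hB : IsSelfAdjoint B) (hBi : ∀ x : B.domain, B x = 0 → x = 0) :
    Function.Surjective (Bbar B) := by
  have hcl : IsClosed ((Bbar B).range : Set H) :=
    (AddMonoidHomClass.isometry_of_norm _ (norm_Bbar B)).isClosedEmbedding.isClosed_range
  have : CompleteSpace (Bbar B).range := hcl.completeSpace_coe
  refine LinearMap.range_eq_top (f := (Bbar B).toLinearMap) |>.1 ?_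
  rw [← Submodule.orthogonal_eq_bot_iff, Submodule.eq_bot_iff]
  intro y hy
  obtain ⟨hy', hBy⟩ := mem_of_sa hB y 0 fun x => by
    rw [inner_zero_left, ← Bbar_coe]
    exact (Submodule.inner_left_of_mem_orthogonal (LinearMap.mem_range_self _ _) hy).symm
  exact congrArg Subtype.val (hBi _ hBy)

theorem dense_hbar2 (hB : IsSelfAdjoint B) (hBi : ∀ x : B.domain, B x = 0 → x = 0) :
    Dense (hbar2 B : Set (Hbar1 B)) :=
  hB.dense_domain.preimage ((Bbar B).isOpenMap (Bbar_surjective hB hBi))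

theorem Abar_apply (φ : Hbar2 B) : Abar B φ = -B ⟨Bbar B (Hbar2.incl B φ), φ.2⟩ := rfl

theorem Hbar2_ext {φ ψ : Hbar2 B} (h : Bbar B (Hbar2.incl B φ) = Bbar B (Hbar2.incl B ψ)) :
    φ = ψ :=
  Subtype.ext (Bbar_injective B h)

theorem exists_Hbar2_Bbar_eq (hB : IsSelfAdjoint B) (hBi : ∀ x : B.domain, B x = 0 → x = 0)
    (u : B.domain) : ∃ φ : Hbar2 B, Bbar B (Hbar2.incl B φ) = u ∧ Abar B φ = -B u := by
  obtain ⟨φ, hφ⟩ := Bbar_surjective hB hBi (u : H)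
  have hmem : φ ∈ hbar2 B := by
    change Bbar B φ ∈ B.domain
    exact hφ ▸ u.2
  refine ⟨Hbar2.mk φ hmem, hφ, ?_⟩
  rw [Abar_apply]
  congr 2
  exact Subtype.ext hφ

theorem norm_Hbar2_sq (φ : Hbar2 B) :
    ‖φ‖ ^ 2 = ‖Abar B φ‖ ^ 2 + ‖Hbar2.incl B φ‖ ^ 2 := by
  rw [Abar_apply, norm_neg, ← norm_Bbar]
  exact norm_H1_sq (Hbar2.emb B φ)

theorem norm_Abar_le (φ : Hbar2 B) : ‖Abar B φ‖ ≤ ‖φ‖ :=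
  le_of_sq_le_sq ((norm_Hbar2_sq φ).symm ▸ le_add_of_nonneg_right (sq_nonneg _)) (norm_nonneg _)

theorem norm_incl_le (φ : Hbar2 B) : ‖Hbar2.incl B φ‖ ≤ ‖φ‖ :=
  le_of_sq_le_sq ((norm_Hbar2_sq φ).symm ▸ le_add_of_nonneg_left (sq_nonneg _)) (norm_nonneg _)

/-- The inclusion of `H̄₂` in `H̄₁` as a bounded operator. -/
def inclL (B : H →ₗ.[𝕜] H) : Hbar2 B →L[𝕜] Hbar1 B :=
  (Hbar2.incl B).mkContinuous 1 fun φ => (norm_incl_le φ).trans_eq (one_mul _).symm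

theorem denseRange_inclL (hB : IsSelfAdjoint B) (hBi : ∀ x : B.domain, B x = 0 → x = 0) :
    DenseRange (inclL B) :=
  (dense_hbar2 hB hBi).mono fun φ hφ => ⟨Hbar2.mk φ hφ, rfl⟩

theorem inner_toHbar1_incl (hB : IsSelfAdjoint B) (x : B.domain) (φ : Hbar2 B) :
    ⟪toHbar1 B x, Hbar2.incl B φ⟫_𝕜 = -⟪(x : H), Abar B φ⟫_𝕜 := by
  rw [inner_Hbar1, Bbar_coe, Abar_apply, inner_neg_right, neg_neg]
  exact symm_of_sa hB x (Hbar2.emb B φ)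

theorem norm_toHbar1 (x : B.domain) : ‖toHbar1 B x‖ = ‖B x‖ := by
  rw [← norm_Bbar, Bbar_coe]

/-- The canonical map from `H₁` to `H̄₁` as a bounded operator. -/
def toHbar1L (B : H →ₗ.[𝕜] H) : H1 B →L[𝕜] Hbar1 B :=
  LinearMap.mkContinuous (σ := RingHom.id 𝕜) (show H1 B →ₗ[𝕜] Hbar1 B from toHbar1 B) 1 fun x => by
    rw [one_mul]
    refine le_of_sq_le_sq ?_ (norm_nonneg _)
    rw [norm_H1_sq]
    refine le_of_eq_of_le ?_ (le_add_of_nonneg_right (sq_nonneg _))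
    exact congrArg (· ^ 2) (norm_toHbar1 (x : B.domain))

end Energy

section Resolvent

variable {𝕜 H : Type*} [RCLike 𝕜] [NormedAddCommGroup H] [InnerProductSpace 𝕜 H] [CompleteSpace H]
variable {B : H →ₗ.[𝕜] H}

theorem sq_R0_add (hB : IsSelfAdjoint B) {l : ℝ} (hl : l ≠ 0) (f : H) :
    B ⟨B ⟨R0 hB hl f, sq_domain_le B (R0 hB hl f).2⟩, (mem_sq_domain.1 (R0 hB hl f).2).2⟩
      + ((l : 𝕜) ^ 2) • (R0 hB hl f : H) = f :=
  sqAdd_R0 hB hl f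

theorem continuous_R0 (hB : IsSelfAdjoint B) {l : ℝ} (hl : l ≠ 0) :
    Continuous fun f => (R0 hB hl f : H) := by
  refine AddMonoidHomClass.continuous_of_bound ((sq B).domain.subtype ∘ₗ R0 hB hl)
    ‖R0L hB hl‖ fun f => le_trans (le_of_sq_le_sq ?_ (norm_nonneg _)) ((R0L hB hl).le_opNorm f)
  rw [norm_H2_sq]
  exact le_add_of_nonneg_left (sq_nonneg _)

theorem R0_comm (hB : IsSelfAdjoint B) {l : ℝ} (hl : l ≠ 0) (x : B.domain) :
    (R0 hB hl (B x) : H) = B ⟨R0 hB hl (x : H), sq_domain_le B (R0 hB hl (x : H)).2⟩ := by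
  obtain ⟨hmem, h⟩ := R0_mem hB hl x
  exact congrArg Subtype.val (sqAdd_injective hB hl ((sqAdd_R0 hB hl _).trans h.symm))

theorem R0bar_coe (hB : IsSelfAdjoint B) {l : ℝ} (hl : l ≠ 0) (x : B.domain) :
    R0bar hB hl (toHbar1 B x) = toHbar2 B (R0 hB hl (x : H)) :=
  haveI := completeSpace_Hbar2 hB
  ContinuousLinearMap.extend_eq _ UniformSpace.Completion.denseRange_coe
    (UniformSpace.Completion.isUniformInducing_coe (EnergyDom B)) _

theorem incl_toHbar2 (u : (sq B).domain) :
    Hbar2.incl B (toHbar2 B u) = toHbar1 B ⟨u, sq_domain_le B u.2⟩ := rfl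

theorem Bbar_R0bar (hB : IsSelfAdjoint B) {l : ℝ} (hl : l ≠ 0) (φ : Hbar1 B) :
    Bbar B (Hbar2.incl B (R0bar hB hl φ)) = R0 hB hl (Bbar B φ) := by
  induction φ using UniformSpace.Completion.induction_on with
  | hp =>
    exact isClosed_eq ((Bbar B).continuous.comp ((inclL B).continuous.comp
      (R0bar hB hl).continuous)) ((continuous_R0 hB hl).comp (Bbar B).continuous)
  | ih x =>
    suffices h : ∀ x : B.domain, Bbar B (Hbar2.incl B (R0bar hB hl (toHbar1 B x))) =
        R0 hB hl (Bbar B (toHbar1 B x)) from h x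
    intro x
    rw [R0bar_coe, incl_toHbar2, Bbar_coe, Bbar_coe, R0_comm]

theorem toHbar2_R0_add_R0bar (hB : IsSelfAdjoint B) {l : ℝ} (hl : l ≠ 0) (φ : Hbar2 B) :
    toHbar2 B (R0 hB hl (-Abar B φ)) + ((l : 𝕜) ^ 2) • R0bar hB hl (Hbar2.incl B φ) = φ := by
  apply Hbar2_ext
  have h := sq_R0_add hB hl (Bbar B (Hbar2.incl B φ))
  rw [map_add, map_add, map_smul, map_smul, Bbar_R0bar, incl_toHbar2, Bbar_coe, Abar_apply,
    neg_neg]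
  conv_rhs => rw [← h]
  congr 2
  exact Subtype.ext (R0_comm hB hl ⟨Bbar B (Hbar2.incl B φ), φ.2⟩)

end Resolvent

section FreeWave

variable {𝕜 H : Type*} [RCLike 𝕜] [NormedAddCommGroup H] [InnerProductSpace 𝕜 H] [CompleteSpace H]
variable {B : H →ₗ.[𝕜] H}

theorem exists_resolvent_W (hB : IsSelfAdjoint B) (hBi : ∀ x : B.domain, B x = 0 → x = 0)
    {m : ℝ} (hm : m ≠ 0) (a : Hbar1 B) (c : H) :
    ∃ (χ : Hbar2 B) (ψ : B.domain), (m : 𝕜) • Hbar2.incl B χ - toHbar1 B ψ = a ∧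
      (m : 𝕜) • (ψ : H) - Abar B χ = c := by
  -- `B̄ χ = m R₀ B̄ a + B R₀ c` and `ψ = m R₀ c - B R₀ B̄ a`
  let r (f : H) : B.domain := ⟨R0 hB hm f, sq_domain_le B (R0 hB hm f).2⟩
  let s (f : H) : B.domain := ⟨B (r f), (mem_sq_domain.1 (R0 hB hm f).2).2⟩
  have hs (f : H) : B (s f) + ((m : 𝕜) ^ 2) • (r f : H) = f := sq_R0_add hB hm f
  obtain ⟨χ, hχ, hAχ⟩ := exists_Hbar2_Bbar_eq hB hBi ((m : 𝕜) • r (Bbar B a) + s c)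
  have hcoe (f g : H) : (((m : 𝕜) • r f + s g : B.domain) : H) = (m : 𝕜) • (r f : H) + B (r g) :=
    rfl
  refine ⟨χ, (m : 𝕜) • r c - s (Bbar B a), Bbar_injective B ?_, ?_⟩
  · rw [map_sub, map_smul, Bbar_coe, hχ, hcoe, B.map_sub, B.map_smul, smul_add, smul_smul,
      ← pow_two]
    nth_rewrite 3 [← hs (Bbar B a)]
    abel
  · have hcoe' : (((m : 𝕜) • r c - s (Bbar B a) : B.domain) : H)
        = (m : 𝕜) • (r c : H) - B (r (Bbar B a)) := rfl
    rw [hAχ, hcoe', B.map_add, B.map_smul, smul_sub, smul_smul, ← pow_two]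
    nth_rewrite 3 [← hs c]
    abel

theorem W_apply (x : (W B).domain) : W B x = WithLp.toLp 2
    (toHbar1 B ⟨x.1.snd, x.2.2⟩, Abar B (Hbar2.mk x.1.fst x.2.1)) := rfl

theorem surjective_sub_W (hB : IsSelfAdjoint B) (hBi : ∀ x : B.domain, B x = 0 → x = 0)
    {m : ℝ} (hm : m ≠ 0) :
    Function.Surjective fun x : (W B).domain => (m : 𝕜) • (x : WithLp 2 (Hbar1 B × H)) - W B x := by
  intro y
  obtain ⟨χ, ψ, hfst, hsnd⟩ := exists_resolvent_W hB hBi hm y.fst y.snd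
  exact ⟨⟨WithLp.toLp 2 (Hbar2.incl B χ, (ψ : H)), χ.2, ψ.2⟩,
    WithLp.ofLp_injective 2 (Prod.ext hfst hsnd)⟩

theorem dense_W_domain (hB : IsSelfAdjoint B) (hBi : ∀ x : B.domain, B x = 0 → x = 0) :
    Dense ((W B).domain : Set (WithLp 2 (Hbar1 B × H))) :=
  ((dense_hbar2 hB hBi).prod hB.dense_domain).preimage
    (WithLp.homeomorphProd 2 (Hbar1 B) H).isOpenMap

theorem inner_W_left (hB : IsSelfAdjoint B) (x y : (W B).domain) :
    ⟪W B x, (y : WithLp 2 (Hbar1 B × H))⟫_𝕜 =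
      ⟪Abar B (Hbar2.mk x.1.fst x.2.1), y.1.snd⟫_𝕜
        - ⟪x.1.snd, Abar B (Hbar2.mk y.1.fst y.2.1)⟫_𝕜 := by
  rw [W_apply, WithLp.prod_inner_apply, sub_eq_neg_add]
  exact congrArg (· + _) (inner_toHbar1_incl hB ⟨x.1.snd, x.2.2⟩ (Hbar2.mk y.1.fst y.2.1))

theorem W_skew_symmetric (hB : IsSelfAdjoint B) (x y : (W B).domain) :
    ⟪W B x, (y : WithLp 2 (Hbar1 B × H))⟫_𝕜 = -⟪(x : WithLp 2 (Hbar1 B × H)), W B y⟫_𝕜 := by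
  rw [← inner_conj_symm (x : WithLp 2 (Hbar1 B × H)), inner_W_left hB, inner_W_left hB, map_sub,
    inner_conj_symm, inner_conj_symm, neg_sub]

theorem isSkewAdjoint_W (hB : IsSelfAdjoint B) (hBi : ∀ x : B.domain, B x = 0 → x = 0) :
    IsSkewAdjoint (W B) :=
  isSkewAdjoint_of_surjective (dense_W_domain hB hBi) (W_skew_symmetric hB)
    (surjective_sub_W hB hBi one_ne_zero)
    (by simpa using surjective_sub_W hB hBi (neg_ne_zero.2 one_ne_zero))

end FreeWave

section BoundaryMap

variable {𝕜 H h : Type*} [RCLike 𝕜]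
variable [NormedAddCommGroup H] [InnerProductSpace 𝕜 H] [CompleteSpace H]
variable [NormedAddCommGroup h] [InnerProductSpace 𝕜 h] {B : H →ₗ.[𝕜] H}

/-- The boundary map `(φ, ζ) ↦ τ φ - Θ ζ` as a bounded operator: `τ_Θ` without its idle middle
component. -/
def tauSub (τ : Hbar2 B →L[𝕜] h) (Θ : h →L[𝕜] h) : Hbar2 B × h →L[𝕜] h :=
  τ.coprod (-Θ)

theorem tauSub_apply (τ : Hbar2 B →L[𝕜] h) (Θ : h →L[𝕜] h) (φ : Hbar2 B) (ζ : h) :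
    tauSub τ Θ (φ, ζ) = τ φ - Θ ζ := by
  rw [tauSub, ContinuousLinearMap.coprod_apply, neg_apply, ← sub_eq_add_neg]

theorem tauSub_surjective {τ : Hbar2 B →L[𝕜] h} {Θ : h →L[𝕜] h}
    (H30 : LinearMap.range (tauTheta τ Θ) = ⊤) : Function.Surjective (tauSub τ Θ) := by
  intro y
  obtain ⟨⟨φ, f, ζ⟩, rfl⟩ := LinearMap.range_eq_top.1 H30 y
  exact ⟨(φ, ζ), tauSub_apply τ Θ φ ζ⟩

end BoundaryMap

section Charges

variable {𝕜 H h V : Type*} [RCLike 𝕜]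
variable [NormedAddCommGroup H] [InnerProductSpace 𝕜 H] [CompleteSpace H]
variable [NormedAddCommGroup h] [InnerProductSpace 𝕜 h] [CompleteSpace h]
variable [AddCommGroup V] [Module 𝕜 V]
variable {B : H →ₗ.[𝕜] H}

theorem inner_Gl (hB : IsSelfAdjoint B) (τ : Hbar2 B →L[𝕜] h) {l : ℝ} (hl : l ≠ 0) (ζ : h) (f : H) :
    ⟪Gl hB τ hl ζ, f⟫_𝕜 = ⟪ζ, τ (toHbar2 B (R0 hB hl f))⟫_𝕜 :=
  ContinuousLinearMap.adjoint_inner_left _ _ _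

theorem inner_Gbar (hB : IsSelfAdjoint B) (τ : Hbar2 B →L[𝕜] h) {l : ℝ} (hl : l ≠ 0) (ζ : h)
    (φ : Hbar1 B) : ⟪Gbar hB τ hl ζ, φ⟫_𝕜 = ⟪ζ, τ (R0bar hB hl φ)⟫_𝕜 :=
  ContinuousLinearMap.adjoint_inner_left _ _ _

-- Green's identity.
theorem inner_tau (hB : IsSelfAdjoint B) (τ : Hbar2 B →L[𝕜] h) {l : ℝ} (hl : l ≠ 0) (ζ : h)
    (φ : Hbar2 B) : ⟪ζ, τ φ⟫_𝕜 = -⟪Gl hB τ hl ζ, Abar B φ⟫_𝕜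
      + (l : 𝕜) ^ 2 * ⟪Gbar hB τ hl ζ, Hbar2.incl B φ⟫_𝕜 := by
  rw [← inner_neg_right, inner_Gl, inner_Gbar, ← inner_smul_right, ← inner_add_right,
    ← map_smul, ← map_add, toHbar2_R0_add_R0bar]

theorem exists_Bbar_Gbar (hB : IsSelfAdjoint B) (τ : Hbar2 B →L[𝕜] h) {l : ℝ} (hl : l ≠ 0) (ζ : h) :
    ∃ hv : Bbar B (Gbar hB τ hl ζ) ∈ B.domain, B ⟨Bbar B (Gbar hB τ hl ζ), hv⟩ = Gl hB τ hl ζ :=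
  mem_of_sa hB _ _ fun x => by
    rw [inner_Gl, ← R0bar_coe, ← inner_Gbar, inner_Hbar1, Bbar_coe]

/-- `Ḡ(l)` as a map into `H̄₂`, which contains its range. -/
def Gbar2 (hB : IsSelfAdjoint B) (τ : Hbar2 B →L[𝕜] h) {l : ℝ} (hl : l ≠ 0) : h →ₗ[𝕜] Hbar2 B :=
  (Gbar hB τ hl).toLinearMap.codRestrict (hbar2 B) fun ζ => (exists_Bbar_Gbar hB τ hl ζ).1

theorem incl_Gbar2 (hB : IsSelfAdjoint B) (τ : Hbar2 B →L[𝕜] h) {l : ℝ} (hl : l ≠ 0) (ζ : h) :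
    Hbar2.incl B (Gbar2 hB τ hl ζ) = Gbar hB τ hl ζ := rfl

theorem Abar_Gbar2 (hB : IsSelfAdjoint B) (τ : Hbar2 B →L[𝕜] h) {l : ℝ} (hl : l ≠ 0) (ζ : h) :
    Abar B (Gbar2 hB τ hl ζ) = -Gl hB τ hl ζ :=
  congrArg Neg.neg (exists_Bbar_Gbar hB τ hl ζ).2

theorem inner_tau_Gbar2 (hB : IsSelfAdjoint B) (τ : Hbar2 B →L[𝕜] h) {l : ℝ} (hl : l ≠ 0)
    (ζ η : h) : ⟪ζ, τ (Gbar2 hB τ hl η)⟫_𝕜 = ⟪Gl hB τ hl ζ, Gl hB τ hl η⟫_𝕜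
      + (l : 𝕜) ^ 2 * ⟪Gbar hB τ hl ζ, Gbar hB τ hl η⟫_𝕜 := by
  rw [inner_tau hB τ hl, Abar_Gbar2, incl_Gbar2, inner_neg_right, neg_neg]

theorem eq_zero_of_tauStar_eq_zero (hB : IsSelfAdjoint B) (hBi : ∀ x : B.domain, B x = 0 → x = 0)
    {τ : Hbar2 B →L[𝕜] h} (hτ : DenseRange τ) {κ : h} (hκ : tauStar hB τ κ = 0) : κ = 0 := by
  have h0 (u : (sq B).domain) : ⟪κ, τ (toHbar2 B u)⟫_𝕜 = 0 := DFunLike.congr_fun hκ u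
  have hGl : Gl hB τ one_ne_zero κ = 0 := by
    rw [← inner_self_eq_zero (𝕜 := 𝕜), inner_Gl, h0]
  have hGbar : Gbar hB τ one_ne_zero κ = 0 := by
    obtain ⟨hv, hBv⟩ := exists_Bbar_Gbar hB τ one_ne_zero κ
    exact Bbar_injective B <|
      (congrArg Subtype.val (hBi _ (hBv.trans hGl))).trans (map_zero (Bbar B)).symm
  refine hτ.eq_zero_of_inner_left 𝕜 fun φ => ?_
  rw [inner_tau hB τ one_ne_zero, hGl, hGbar, inner_zero_left, inner_zero_left, mul_zero, neg_zero,
    add_zero]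

theorem eq_zero_of_inner_tau_eq (hB : IsSelfAdjoint B) (hBi : ∀ x : B.domain, B x = 0 → x = 0)
    {τ : Hbar2 B →L[𝕜] h} (hτ : DenseRange τ)
    (H31 : Set.range (tauStar hB τ) ∩ HNegOne hB = {0}) {κ : h} (F : StrongDual 𝕜 (Hbar1 B))
    (hF : ∀ φ : Hbar2 B, ⟪κ, τ φ⟫_𝕜 = F (Hbar2.incl B φ)) : κ = 0 := by
  have hneg : tauStar hB τ κ ∈ HNegOne hB :=
    ⟨F.comp (toHbar1L B), ContinuousLinearMap.ext fun u => (hF (toHbar2 B u)).symm⟩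
  exact eq_zero_of_tauStar_eq_zero hB hBi hτ (H31.subset ⟨⟨κ, rfl⟩, hneg⟩)

theorem eq_zero_of_comp_tau_eq (hB : IsSelfAdjoint B) (hBi : ∀ x : B.domain, B x = 0 → x = 0)
    {τ : Hbar2 B →L[𝕜] h} (hτ : DenseRange τ)
    (H31 : Set.range (tauStar hB τ) ∩ HNegOne hB = {0}) (f : StrongDual 𝕜 h)
    (F : StrongDual 𝕜 (Hbar1 B)) (hf : f.comp τ = F.comp (inclL B)) : f = 0 := by
  obtain ⟨κ, rfl⟩ := (InnerProductSpace.toDual 𝕜 h).surjective f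
  rw [eq_zero_of_inner_tau_eq hB hBi hτ H31 F (DFunLike.congr_fun hf), map_zero]

theorem eq_zero_of_Gl_mem (hB : IsSelfAdjoint B) (hBi : ∀ x : B.domain, B x = 0 → x = 0)
    {τ : Hbar2 B →L[𝕜] h} (hτ : DenseRange τ)
    (H31 : Set.range (tauStar hB τ) ∩ HNegOne hB = {0}) {l : ℝ} (hl : l ≠ 0) {κ : h}
    (hκ : Gl hB τ hl κ ∈ B.domain) : κ = 0 := by
  refine eq_zero_of_inner_tau_eq hB hBi hτ H31
    (innerSL 𝕜 (toHbar1 B ⟨_, hκ⟩ + ((l : 𝕜) ^ 2) • Gbar hB τ hl κ)) fun φ => ?_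
  rw [inner_tau hB τ hl, innerSL_apply_apply, inner_add_left, inner_toHbar1_incl hB,
    inner_smul_left, map_pow, RCLike.conj_ofReal]

theorem exists_Gl_sub (hB : IsSelfAdjoint B) (hBi : ∀ x : B.domain, B x = 0 → x = 0)
    (τ : Hbar2 B →L[𝕜] h) {l m : ℝ} (hl : l ≠ 0) (hm : m ≠ 0) (ζ : h) :
    ∃ x : B.domain, (x : H) = Gl hB τ hm ζ - Gl hB τ hl ζ ∧
      toHbar1 B x = ((l : 𝕜) ^ 2) • Gbar hB τ hl ζ - ((m : 𝕜) ^ 2) • Gbar hB τ hm ζ := by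
  obtain ⟨hx, hBx⟩ := mem_of_sa hB (Gl hB τ hm ζ - Gl hB τ hl ζ)
    (Bbar B (((l : 𝕜) ^ 2) • Gbar hB τ hl ζ - ((m : 𝕜) ^ 2) • Gbar hB τ hm ζ)) fun x => by
      obtain ⟨φ, hφ, hAφ⟩ := exists_Hbar2_Bbar_eq hB hBi x
      have green := (inner_tau hB τ hm ζ φ).symm.trans (inner_tau hB τ hl ζ φ)
      rw [hAφ, inner_neg_right, inner_neg_right] at green
      rw [← hφ, ← inner_Hbar1, inner_sub_left, inner_sub_left, inner_smul_left, inner_smul_left,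
        map_pow, map_pow, RCLike.conj_ofReal, RCLike.conj_ofReal]
      linear_combination -green
  exact ⟨⟨_, hx⟩, rfl, Bbar_injective B ((Bbar_coe B _).trans hBx)⟩

theorem G_apply (hB : IsSelfAdjoint B) (τ : Hbar2 B →L[𝕜] h) (i₀ : H →ₗ[𝕜] V)
    (i₁ : Hbar1 B →ₗ[𝕜] V) {l : ℝ} (hl : l ≠ 0) (ζ : h) :
    G hB τ i₀ i₁ hl ζ = i₀ (Gl hB τ hl ζ) + ((l : 𝕜) ^ 2) • i₁ (Gbar hB τ hl ζ) := rfl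

theorem G_eq_G (hB : IsSelfAdjoint B) (hBi : ∀ x : B.domain, B x = 0 → x = 0)
    (τ : Hbar2 B →L[𝕜] h) {i₀ : H →ₗ[𝕜] V} {i₁ : Hbar1 B →ₗ[𝕜] V} (H32 : IsCommonSpace B i₀ i₁)
    {l m : ℝ} (hl : l ≠ 0) (hm : m ≠ 0) : G hB τ i₀ i₁ hm = G hB τ i₀ i₁ hl := by
  ext ζ
  obtain ⟨x, hx, hx'⟩ := exists_Gl_sub hB hBi τ hl hm ζ
  have hcompat := H32.compat x
  rw [hx, hx', map_sub, map_sub, map_smul, map_smul, sub_eq_sub_iff_add_eq_add] at hcompat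
  rw [G_apply, G_apply, hcompat, add_comm]

theorem eq_sumMap_iff (hB : IsSelfAdjoint B) (τ : Hbar2 B →L[𝕜] h) {i₀ : H →ₗ[𝕜] V}
    {i₁ : Hbar1 B →ₗ[𝕜] V} (H32 : IsCommonSpace B i₀ i₁) {l : ℝ} (hl : l ≠ 0) (ψ : H)
    (φ : Hbar1 B) (ξ : h) : i₀ ψ = sumMap i₁ (G hB τ i₀ i₁ hl) (φ, ξ) ↔
      ∃ ψ' : B.domain, ψ = (ψ' : H) + Gl hB τ hl ξ ∧
        φ = toHbar1 B ψ' - ((l : 𝕜) ^ 2) • Gbar hB τ hl ξ := by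
  rw [sumMap, LinearMap.coprod_apply, G_apply]
  constructor
  · intro h
    have hV : i₀ (ψ - Gl hB τ hl ξ) = i₁ (φ + ((l : 𝕜) ^ 2) • Gbar hB τ hl ξ) := by
      rw [map_sub, h, map_add, map_smul]
      abel
    have hx := H32.inter _ _ hV
    exact ⟨⟨_, hx⟩, (sub_add_cancel _ _).symm,
      eq_sub_of_add_eq (H32.inj₁ (hV.symm.trans (H32.compat ⟨_, hx⟩)))⟩
  · rintro ⟨ψ', rfl, rfl⟩
    rw [map_add, H32.compat, map_sub, map_smul]
    abel

theorem sumMap_injective (hB : IsSelfAdjoint B) (hBi : ∀ x : B.domain, B x = 0 → x = 0)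
    {τ : Hbar2 B →L[𝕜] h} (hτ : DenseRange τ)
    (H31 : Set.range (tauStar hB τ) ∩ HNegOne hB = {0}) {i₀ : H →ₗ[𝕜] V}
    {i₁ : Hbar1 B →ₗ[𝕜] V} (H32 : IsCommonSpace B i₀ i₁) {l : ℝ} (hl : l ≠ 0) :
    Function.Injective (sumMap i₁ (G hB τ i₀ i₁ hl)) := by
  rw [injective_iff_map_eq_zero]
  rintro ⟨φ, ζ⟩ h0
  obtain ⟨ψ', hψ', rfl⟩ := (eq_sumMap_iff hB τ H32 hl 0 φ ζ).1 (by rw [h0, map_zero])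
  have hmem : Gl hB τ hl ζ ∈ B.domain :=
    neg_eq_of_add_eq_zero_right hψ'.symm ▸ B.domain.neg_mem ψ'.2
  obtain rfl : ζ = 0 := eq_zero_of_Gl_mem hB hBi hτ H31 hl hmem
  rw [map_zero, add_zero] at hψ'
  obtain rfl : ψ' = 0 := Subtype.ext hψ'.symm
  rw [map_zero, map_zero, smul_zero, sub_zero, Prod.mk_zero_zero]

end Charges

section ChargeOperator

variable {𝕜 H h : Type*} [RCLike 𝕜]
variable [NormedAddCommGroup H] [InnerProductSpace 𝕜 H] [CompleteSpace H]
variable [NormedAddCommGroup h] [InnerProductSpace 𝕜 h] [CompleteSpace h]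
variable {B : H →ₗ.[𝕜] H}

/-- The operator `Θ + m² τ Ḡ(m)` on `h`, whose inverse gives the charge of `(-W_Θ + m)⁻¹ x`. -/
def chargeOp (hB : IsSelfAdjoint B) (τ : Hbar2 B →L[𝕜] h) (Θ : h →L[𝕜] h) {m : ℝ} (hm : m ≠ 0) :
    h →ₗ[𝕜] h :=
  Θ.toLinearMap + ((m : 𝕜) ^ 2) • τ.toLinearMap ∘ₗ Gbar2 hB τ hm

theorem chargeOp_apply (hB : IsSelfAdjoint B) (τ : Hbar2 B →L[𝕜] h) (Θ : h →L[𝕜] h) {m : ℝ}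
    (hm : m ≠ 0) (ζ : h) :
    chargeOp hB τ Θ hm ζ = Θ ζ + ((m : 𝕜) ^ 2) • τ (Gbar2 hB τ hm ζ) := rfl

theorem inner_chargeOp_right (hB : IsSelfAdjoint B) (τ : Hbar2 B →L[𝕜] h) (Θ : h →L[𝕜] h) {m : ℝ}
    (hm : m ≠ 0) (ζ η : h) : ⟪ζ, chargeOp hB τ Θ hm η⟫_𝕜 = ⟪ζ, Θ η⟫_𝕜
      + ((m ^ 2 : ℝ) : 𝕜) * (⟪Gl hB τ hm ζ, Gl hB τ hm η⟫_𝕜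
        + ((m ^ 2 : ℝ) : 𝕜) * ⟪Gbar hB τ hm ζ, Gbar hB τ hm η⟫_𝕜) := by
  rw [chargeOp_apply, inner_add_right, inner_smul_right, inner_tau_Gbar2, RCLike.ofReal_pow]

theorem isSymmetric_chargeOp (hB : IsSelfAdjoint B) (τ : Hbar2 B →L[𝕜] h) {Θ : h →L[𝕜] h}
    (hΘ : Θ.toLinearMap.IsSymmetric) {m : ℝ} (hm : m ≠ 0) :
    (chargeOp hB τ Θ hm).IsSymmetric := by
  intro ζ η
  have hs : ⟪Θ ζ, η⟫_𝕜 = ⟪ζ, Θ η⟫_𝕜 := hΘ ζ η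
  rw [← inner_conj_symm, inner_chargeOp_right, inner_chargeOp_right, ← hs]
  simp only [map_add, map_mul, RCLike.conj_ofReal, inner_conj_symm]

theorem re_inner_chargeOp (hB : IsSelfAdjoint B) (τ : Hbar2 B →L[𝕜] h) (Θ : h →L[𝕜] h) {m : ℝ}
    (hm : m ≠ 0) (ζ : h) : RCLike.re ⟪ζ, chargeOp hB τ Θ hm ζ⟫_𝕜 = RCLike.re ⟪ζ, Θ ζ⟫_𝕜
      + m ^ 2 * (‖Gl hB τ hm ζ‖ ^ 2 + m ^ 2 * ‖Gbar hB τ hm ζ‖ ^ 2) := by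
  rw [inner_chargeOp_right, map_add, RCLike.re_ofReal_mul, map_add, RCLike.re_ofReal_mul,
    inner_self_eq_norm_sq, inner_self_eq_norm_sq]

theorem norm_inner_tauSub_le (hB : IsSelfAdjoint B) (τ : Hbar2 B →L[𝕜] h) {Θ : h →L[𝕜] h}
    (hΘ : Θ.toLinearMap.IsSymmetric) {m : ℝ} (hm : m ≠ 0) (ξ : h) (x : Hbar2 B × h) :
    ‖⟪ξ, tauSub τ Θ x⟫_𝕜‖ ≤
      (‖Gl hB τ hm ξ‖ + m ^ 2 * ‖Gbar hB τ hm ξ‖ + ‖Θ ξ‖) * ‖x‖ := by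
  obtain ⟨φ, ζ⟩ := x
  have hs : ⟪Θ ξ, ζ⟫_𝕜 = ⟪ξ, Θ ζ⟫_𝕜 := hΘ ξ ζ
  have hm2 : ‖(m : 𝕜) ^ 2‖ = m ^ 2 := by rw [norm_pow, RCLike.norm_ofReal, sq_abs]
  rw [tauSub_apply, inner_sub_right, inner_tau hB τ hm, ← hs]
  calc _ ≤ ‖⟪Gl hB τ hm ξ, Abar B φ⟫_𝕜‖ + m ^ 2 * ‖⟪Gbar hB τ hm ξ, Hbar2.incl B φ⟫_𝕜‖
        + ‖⟪Θ ξ, ζ⟫_𝕜‖ := by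
        refine (norm_sub_le _ _).trans (add_le_add_left ((norm_add_le _ _).trans_eq ?_) _)
        rw [norm_neg, norm_mul, hm2]
    _ ≤ ‖Gl hB τ hm ξ‖ * ‖Abar B φ‖ + m ^ 2 * (‖Gbar hB τ hm ξ‖ * ‖Hbar2.incl B φ‖)
        + ‖Θ ξ‖ * ‖ζ‖ := by gcongr <;> exact norm_inner_le_norm _ _
    _ ≤ ‖Gl hB τ hm ξ‖ * ‖(φ, ζ)‖ + m ^ 2 * (‖Gbar hB τ hm ξ‖ * ‖(φ, ζ)‖)
        + ‖Θ ξ‖ * ‖(φ, ζ)‖ := by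
        have hφ : ‖φ‖ ≤ ‖(φ, ζ)‖ := norm_fst_le (φ, ζ)
        gcongr
        · exact (norm_Abar_le φ).trans hφ
        · exact (norm_incl_le φ).trans hφ
        · exact norm_snd_le (φ, ζ)
    _ = _ := by ring

theorem exists_norm_le_mul_norm_Gl_add (hB : IsSelfAdjoint B) {τ : Hbar2 B →L[𝕜] h} {Θ : h →L[𝕜] h}
    (hΘ : Θ.toLinearMap.IsSymmetric) (hS : Function.Surjective (tauSub τ Θ)) {m : ℝ} (hm : m ≠ 0) :
    ∃ C > 0, ∀ ξ : h, ‖ξ‖ ≤ C * (‖Gl hB τ hm ξ‖ + m ^ 2 * ‖Gbar hB τ hm ξ‖ + ‖Θ ξ‖) := by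
  have := completeSpace_Hbar2 hB
  obtain ⟨C, hC, hpre⟩ := (tauSub τ Θ).exists_preimage_norm_le hS
  refine ⟨C, hC, fun ξ => ?_⟩
  obtain ⟨x, hx, hxC⟩ := hpre ξ
  rcases (norm_nonneg ξ).eq_or_lt with h0 | h0
  · rw [← h0]
    positivity
  · refine le_of_mul_le_mul_right ?_ h0
    calc ‖ξ‖ * ‖ξ‖ = ‖⟪ξ, tauSub τ Θ x⟫_𝕜‖ := by
          rw [hx, ← inner_self_re_eq_norm, inner_self_eq_norm_mul_norm]
      _ ≤ _ := norm_inner_tauSub_le hB τ hΘ hm ξ x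
      _ ≤ (‖Gl hB τ hm ξ‖ + m ^ 2 * ‖Gbar hB τ hm ξ‖ + ‖Θ ξ‖) * (C * ‖ξ‖) := by gcongr
      _ = _ := by ring

theorem exists_norm_sq_le_mul_re_inner_chargeOp (hB : IsSelfAdjoint B) {τ : Hbar2 B →L[𝕜] h}
    {Θ : h →L[𝕜] h} (hΘ : Θ.IsPositive) (hS : Function.Surjective (tauSub τ Θ)) {m : ℝ}
    (hm : m ≠ 0) :
    ∃ K > 0, ∀ ξ : h, ‖ξ‖ ^ 2 ≤ K * RCLike.re ⟪ξ, chargeOp hB τ Θ hm ξ⟫_𝕜 := by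
  obtain ⟨C, hC, hle⟩ := exists_norm_le_mul_norm_Gl_add hB hΘ.isSymmetric hS hm
  have hm2 : 0 < m ^ 2 := by positivity
  refine ⟨C ^ 2 * (3 * ((m ^ 2)⁻¹ + 1 + ‖Θ‖)), by positivity, fun ξ => ?_⟩
  have hΘξ : ‖Θ ξ‖ ^ 2 ≤ ‖Θ‖ * RCLike.re ⟪ξ, Θ ξ⟫_𝕜 := by
    rw [inner_re_symm]
    exact norm_apply_sq_le_of_isPositive hΘ ξ
  have hΘ0 := hΘ.re_inner_nonneg_right ξ
  rw [re_inner_chargeOp]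
  specialize hle ξ
  set a := ‖Gl hB τ hm ξ‖
  set b := m ^ 2 * ‖Gbar hB τ hm ξ‖
  set t := RCLike.re ⟪ξ, Θ ξ⟫_𝕜
  have hq : m ^ 2 * (a ^ 2 + m ^ 2 * ‖Gbar hB τ hm ξ‖ ^ 2) = m ^ 2 * a ^ 2 + b ^ 2 := by ring
  rw [hq]
  set q := t + (m ^ 2 * a ^ 2 + b ^ 2)
  have ha : a ^ 2 ≤ (m ^ 2)⁻¹ * q := by
    rw [← div_eq_inv_mul, le_div_iff₀ hm2]
    nlinarith [sq_nonneg b]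
  have hb : b ^ 2 ≤ 1 * q := by nlinarith [mul_nonneg hm2.le (sq_nonneg a)]
  have hc : ‖Θ ξ‖ ^ 2 ≤ ‖Θ‖ * q :=
    hΘξ.trans (mul_le_mul_of_nonneg_left (le_add_of_nonneg_right (by positivity)) (norm_nonneg Θ))
  calc ‖ξ‖ ^ 2 ≤ (C * (a + b + ‖Θ ξ‖)) ^ 2 := by gcongr
    _ = C ^ 2 * (a + b + ‖Θ ξ‖) ^ 2 := mul_pow _ _ _
    _ ≤ C ^ 2 * (3 * (a ^ 2 + b ^ 2 + ‖Θ ξ‖ ^ 2)) := by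
        gcongr
        nlinarith [sq_nonneg (a - b), sq_nonneg (a - ‖Θ ξ‖), sq_nonneg (b - ‖Θ ξ‖)]
    _ ≤ C ^ 2 * (3 * ((m ^ 2)⁻¹ * q + 1 * q + ‖Θ‖ * q)) := by gcongr
    _ = _ := by ring

theorem surjective_chargeOp (hB : IsSelfAdjoint B) {τ : Hbar2 B →L[𝕜] h} {Θ : h →L[𝕜] h}
    (hΘ : Θ.IsPositive) (hS : Function.Surjective (tauSub τ Θ)) {m : ℝ} (hm : m ≠ 0) :
    Function.Surjective (chargeOp hB τ Θ hm) := by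
  obtain ⟨K, hK, hcoer⟩ := exists_norm_sq_le_mul_re_inner_chargeOp hB hΘ hS hm
  have hsymm := isSymmetric_chargeOp hB τ hΘ.isSymmetric hm
  let P : h →L[𝕜] h := ⟨chargeOp hB τ Θ hm, hsymm.continuous⟩
  have hunit : IsUnit P := by
    refine P.isUnit_of_forall_le_norm_inner_map (c := (Real.toNNReal K)⁻¹) (by simpa using hK)
      fun ξ => ?_
    rw [NNReal.coe_inv, Real.coe_toNNReal _ hK.le, mul_inv_le_iff₀ hK, mul_comm, norm_inner_symm]
    exact (hcoer ξ).trans (mul_le_mul_of_nonneg_left (RCLike.re_le_norm _) hK.le)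
  exact (ContinuousLinearMap.isUnit_iff_bijective.1 hunit).2

end ChargeOperator

section ThetaNorm

variable {𝕜 h : Type*} [RCLike 𝕜] [NormedAddCommGroup h] [InnerProductSpace 𝕜 h] [CompleteSpace h]
variable (Θ : h →L[𝕜] h) (hΘ : Θ.IsPositive) (hΘi : Function.Injective Θ)

theorem HTheta.norm_sq (ζ : HTheta Θ hΘ hΘi) :
    ‖ζ‖ ^ 2 = RCLike.re ⟪Θ (HTheta.val Θ hΘ hΘi ζ), HTheta.val Θ hΘ hΘi ζ⟫_𝕜 :=
  (inner_self_eq_norm_sq (𝕜 := 𝕜) ζ).symm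

theorem HTheta.norm_val_symm_le (ζ : h) :
    ‖(HTheta.val Θ hΘ hΘi).symm ζ‖ ≤ √‖Θ‖ * ‖ζ‖ := by
  refine (sq_le_sq₀ (norm_nonneg _) (by positivity)).1 ?_
  rw [HTheta.norm_sq, LinearEquiv.apply_symm_apply, mul_pow, Real.sq_sqrt (norm_nonneg _),
    pow_two, ← mul_assoc]
  exact (re_inner_le_norm _ _).trans
    (mul_le_mul_of_nonneg_right (Θ.le_opNorm ζ) (norm_nonneg _))

theorem HTheta.norm_apply_val_le (ζ : HTheta Θ hΘ hΘi) :
    ‖Θ (HTheta.val Θ hΘ hΘi ζ)‖ ≤ √‖Θ‖ * ‖ζ‖ := by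
  refine (sq_le_sq₀ (norm_nonneg _) (by positivity)).1 ?_
  rw [mul_pow, Real.sq_sqrt (norm_nonneg _), HTheta.norm_sq]
  exact norm_apply_sq_le_of_isPositive hΘ _

theorem completeSpace_HTheta (hs : Function.Surjective Θ) : CompleteSpace (HTheta Θ hΘ hΘi) := by
  obtain ⟨C, hC, hS⟩ := Θ.exists_preimage_norm_le hs
  let e := (HTheta.val Θ hΘ hΘi).toContinuousLinearEquivOfBounds (C * √‖Θ‖) √‖Θ‖
    (fun ζ => by
      obtain ⟨x, hx, hn⟩ := hS (Θ (HTheta.val Θ hΘ hΘi ζ))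
      rw [hΘi hx] at hn
      rw [mul_assoc]
      exact hn.trans (mul_le_mul_of_nonneg_left (HTheta.norm_apply_val_le Θ hΘ hΘi ζ) hC.le))
    (HTheta.norm_val_symm_le Θ hΘ hΘi)
  exact (completeSpace_congr (e := e.toEquiv) e.isUniformEmbedding).2 inferInstance

end ThetaNorm

section PerturbedSpaces

variable {𝕜 H h V : Type*} [RCLike 𝕜]
variable [NormedAddCommGroup H] [InnerProductSpace 𝕜 H]
variable [NormedAddCommGroup h] [InnerProductSpace 𝕜 h]
variable [AddCommGroup V] [Module 𝕜 V] {B : H →ₗ.[𝕜] H}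
variable (i₁ : Hbar1 B →ₗ[𝕜] V) (g : h →ₗ[𝕜] V) (Θ : h →L[𝕜] h)
  (hΘ : Θ.IsPositive) (hΘi : Function.Injective Θ) (hU : Function.Injective (sumMap i₁ g))

theorem Kbar1.reg_equiv (p : Hbar1 B × h) :
    Kbar1.reg i₁ g Θ hΘ hΘi hU (Kbar1.equiv i₁ g Θ hΘ hΘi hU p) = p.1 :=
  congrArg Prod.fst ((Kbar1.equiv i₁ g Θ hΘ hΘi hU).symm_apply_apply p)

theorem Kbar1.charge_equiv (p : Hbar1 B × h) :
    Kbar1.charge i₁ g Θ hΘ hΘi hU (Kbar1.equiv i₁ g Θ hΘ hΘi hU p) = p.2 :=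
  congrArg Prod.snd ((Kbar1.equiv i₁ g Θ hΘ hΘi hU).symm_apply_apply p)

theorem Kbar1.mk_eq_equiv {v : V} (hv : v ∈ LinearMap.range (sumMap i₁ g)) {p : Hbar1 B × h}
    (h : v = sumMap i₁ g p) :
    Kbar1.mk i₁ g Θ hΘ hΘi hU v hv = Kbar1.equiv i₁ g Θ hΘ hΘi hU p :=
  Subtype.ext h

/-- The vector `(φ + g ζ, ψ)` of `K̄₁ ⊕ H`, as a linear function of `((φ, ζ), ψ)`. -/
def KTot.ofParts : ((Hbar1 B × h) × H) ≃ₗ[𝕜] KTot i₁ g Θ hΘ hΘi hU :=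
  ((Kbar1.equiv i₁ g Θ hΘ hΘi hU).prodCongr (LinearEquiv.refl 𝕜 H)).trans
    (WithLp.linearEquiv 2 𝕜 (Kbar1 i₁ g Θ hΘ hΘi hU × H)).symm

theorem KTot.ofParts_reg_charge (x : KTot i₁ g Θ hΘ hΘi hU) :
    KTot.ofParts i₁ g Θ hΘ hΘi hU ((Kbar1.reg i₁ g Θ hΘ hΘi hU x.fst,
      Kbar1.charge i₁ g Θ hΘ hΘi hU x.fst), x.snd) = x :=
  (KTot.ofParts i₁ g Θ hΘ hΘi hU).apply_symm_apply x

variable [CompleteSpace h]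

theorem Kbar1.inner_equiv (p q : Hbar1 B × h) :
    ⟪Kbar1.equiv i₁ g Θ hΘ hΘi hU p, Kbar1.equiv i₁ g Θ hΘ hΘi hU q⟫_𝕜 =
      ⟪p.1, q.1⟫_𝕜 + ⟪Θ p.2, q.2⟫_𝕜 := by
  have emb_equiv (p : Hbar1 B × h) :
      Kbar1.emb i₁ g Θ hΘ hΘi hU (Kbar1.equiv i₁ g Θ hΘ hΘi hU p) =
        WithLp.toLp 2 (p.1, (HTheta.val Θ hΘ hΘi).symm p.2) :=
    congrArg (WithLp.toLp 2) ((Kbar1.equiv i₁ g Θ hΘ hΘi hU).symm_apply_apply p)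
  change ⟪Kbar1.emb i₁ g Θ hΘ hΘi hU _, Kbar1.emb i₁ g Θ hΘ hΘi hU _⟫_𝕜 = _
  rw [emb_equiv, emb_equiv, WithLp.prod_inner_apply]
  rfl

theorem KTot.inner_ofParts (p q : (Hbar1 B × h) × H) :
    ⟪KTot.ofParts i₁ g Θ hΘ hΘi hU p, KTot.ofParts i₁ g Θ hΘ hΘi hU q⟫_𝕜 =
      ⟪p.1.1, q.1.1⟫_𝕜 + ⟪Θ p.1.2, q.1.2⟫_𝕜 + ⟪p.2, q.2⟫_𝕜 := by
  rw [WithLp.prod_inner_apply, ← Kbar1.inner_equiv i₁ g Θ hΘ hΘi hU]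
  rfl

theorem KTot.norm_ofParts_sq (p : (Hbar1 B × h) × H) :
    ‖KTot.ofParts i₁ g Θ hΘ hΘi hU p‖ ^ 2 =
      ‖p.1.1‖ ^ 2 + RCLike.re ⟪Θ p.1.2, p.1.2⟫_𝕜 + ‖p.2‖ ^ 2 := by
  rw [← inner_self_eq_norm_sq (𝕜 := 𝕜), KTot.inner_ofParts, map_add, map_add,
    inner_self_eq_norm_sq, inner_self_eq_norm_sq]

theorem norm_incl (x : WithLp 2 (Hbar1 B × H)) : ‖incl i₁ g Θ hΘ hΘi hU x‖ = ‖x‖ := by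
  have h : incl i₁ g Θ hΘ hΘi hU x = KTot.ofParts i₁ g Θ hΘ hΘi hU ((x.fst, 0), x.snd) := rfl
  rw [← sq_eq_sq₀ (norm_nonneg _) (norm_nonneg _), h, KTot.norm_ofParts_sq,
    WithLp.prod_norm_sq_eq_of_L2, map_zero, inner_zero_left, map_zero, add_zero]

/-- The unitary map `U(φ₀, ψ, ζ) = (φ₀ + g ζ, ψ)`. -/
def KTot.isometryEquiv : HTot B Θ hΘ hΘi ≃ₗᵢ[𝕜] KTot i₁ g Θ hΘ hΘi hU where
  toFun x := KTot.ofParts i₁ g Θ hΘ hΘi hU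
    ((x.fst, HTheta.val Θ hΘ hΘi x.snd.snd), x.snd.fst)
  invFun y := WithLp.toLp 2 (Kbar1.reg i₁ g Θ hΘ hΘi hU y.fst, WithLp.toLp 2 (y.snd,
    (HTheta.val Θ hΘ hΘi).symm (Kbar1.charge i₁ g Θ hΘ hΘi hU y.fst)))
  map_add' x y := map_add (KTot.ofParts i₁ g Θ hΘ hΘi hU)
    ((x.fst, HTheta.val Θ hΘ hΘi x.snd.snd), x.snd.fst)
    ((y.fst, HTheta.val Θ hΘ hΘi y.snd.snd), y.snd.fst)
  map_smul' c x := map_smul (KTot.ofParts i₁ g Θ hΘ hΘi hU) c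
    ((x.fst, HTheta.val Θ hΘ hΘi x.snd.snd), x.snd.fst)
  left_inv x := by
    refine WithLp.ofLp_injective 2 (Prod.ext ?_ (WithLp.ofLp_injective 2 (Prod.ext rfl ?_)))
    · exact Kbar1.reg_equiv i₁ g Θ hΘ hΘi hU _
    · exact congrArg (HTheta.val Θ hΘ hΘi).symm (Kbar1.charge_equiv i₁ g Θ hΘ hΘi hU _)
  right_inv := KTot.ofParts_reg_charge i₁ g Θ hΘ hΘi hU
  norm_map' x := by
    rw [← sq_eq_sq₀ (norm_nonneg _) (norm_nonneg _)]
    refine (KTot.norm_ofParts_sq i₁ g Θ hΘ hΘi hU _).trans ?_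
    rw [WithLp.prod_norm_sq_eq_of_L2, WithLp.prod_norm_sq_eq_of_L2, HTheta.norm_sq]
    ring

theorem KTot.isometryEquiv_toLp (φ₀ : Hbar1 B) (ψ : H) (ζ : h) :
    KTot.isometryEquiv i₁ g Θ hΘ hΘi hU
      (WithLp.toLp 2 (φ₀, WithLp.toLp 2 (ψ, (HTheta.val Θ hΘ hΘi).symm ζ))) =
      WithLp.toLp 2 (Kbar1.mk i₁ g Θ hΘ hΘi hU (i₁ φ₀ + g ζ) ⟨(φ₀, ζ), rfl⟩, ψ) := rfl

theorem KTot.continuous_ofParts : Continuous (KTot.ofParts i₁ g Θ hΘ hΘi hU) := by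
  have hval : Continuous (HTheta.val Θ hΘ hΘi).symm :=
    AddMonoidHomClass.continuous_of_bound _ _ (HTheta.norm_val_symm_le Θ hΘ hΘi)
  refine (KTot.isometryEquiv i₁ g Θ hΘ hΘi hU).continuous.comp
    (g := KTot.isometryEquiv i₁ g Θ hΘ hΘi hU) (f := fun p : (Hbar1 B × h) × H =>
      WithLp.toLp 2 (p.1.1, WithLp.toLp 2 (p.2, (HTheta.val Θ hΘ hΘi).symm p.1.2))) ?_
  fun_prop

theorem completeSpace_KTot [CompleteSpace H] (hs : Function.Surjective Θ) :
    CompleteSpace (KTot i₁ g Θ hΘ hΘi hU) := by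
  have := completeSpace_HTheta Θ hΘ hΘi hs
  let U := KTot.isometryEquiv i₁ g Θ hΘ hΘi hU
  exact (completeSpace_congr (e := U.toEquiv) U.isometry.isUniformEmbedding).1 inferInstance

end PerturbedSpaces

section PerturbedWave

variable {𝕜 H h V : Type*} [RCLike 𝕜]
variable [NormedAddCommGroup H] [InnerProductSpace 𝕜 H] [CompleteSpace H]
variable [NormedAddCommGroup h] [InnerProductSpace 𝕜 h] [CompleteSpace h]
variable [AddCommGroup V] [Module 𝕜 V]
variable {B : H →ₗ.[𝕜] H} {Θ : h →L[𝕜] h} {τ : Hbar2 B →L[𝕜] h}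
variable {i₀ : H →ₗ[𝕜] V} {i₁ : Hbar1 B →ₗ[𝕜] V} {g : h →ₗ[𝕜] V}

theorem mem_graph_WTheta (hB : IsSelfAdjoint B) (hΘ : Θ.IsPositive) (hΘi : Function.Injective Θ)
    (H32 : IsCommonSpace B i₀ i₁) (hU : Function.Injective (sumMap i₁ g)) {m : ℝ} (hm : m ≠ 0)
    (hg : g = G hB τ i₀ i₁ hm) (x y : KTot i₁ g Θ hΘ hΘi hU) :
    (x, y) ∈ (WTheta i₀ i₁ g Θ hΘ hΘi hU τ).graph ↔
      ∃ (φ₀ : Hbar2 B) (ψ' : B.domain) (ζ ξ : h), Θ ζ = τ φ₀ ∧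
        x = KTot.ofParts i₁ g Θ hΘ hΘi hU ((Hbar2.incl B φ₀, ζ), (ψ' : H) + Gl hB τ hm ξ) ∧
        y = KTot.ofParts i₁ g Θ hΘ hΘi hU
          ((toHbar1 B ψ' - (m : 𝕜) ^ 2 • Gbar hB τ hm ξ, ξ), Abar B φ₀) := by
  subst hg
  rw [LinearPMap.mem_graph_iff]
  constructor
  · rintro ⟨⟨x, hx⟩, rfl, rfl⟩
    obtain ⟨⟨φ₀, hφ₀, hbc⟩, ⟨⟨φ₁, ξ⟩, hV⟩⟩ := id hx
    obtain ⟨ψ', hψ, rfl⟩ := (eq_sumMap_iff hB τ H32 hm x.snd φ₁ ξ).1 hV.symm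
    refine ⟨φ₀, ψ', _, ξ, hbc, ?_, ?_⟩
    · rw [hφ₀, ← hψ, KTot.ofParts_reg_charge]
    · exact WithLp.ofLp_injective 2 (Prod.ext (Kbar1.mk_eq_equiv i₁ _ Θ hΘ hΘi hU _ hV.symm)
        (congrArg (Abar B) (Subtype.ext hφ₀.symm)))
  · rintro ⟨φ₀, ψ', ζ, ξ, hbc, rfl, rfl⟩
    have hV := (eq_sumMap_iff hB τ H32 hm _ _ ξ).2 ⟨ψ', rfl, rfl⟩
    have hr := Kbar1.reg_equiv i₁ (G hB τ i₀ i₁ hm) Θ hΘ hΘi hU (Hbar2.incl B φ₀, ζ)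
    have hc := Kbar1.charge_equiv i₁ (G hB τ i₀ i₁ hm) Θ hΘ hΘi hU (Hbar2.incl B φ₀, ζ)
    exact ⟨⟨KTot.ofParts i₁ _ Θ hΘ hΘi hU ((Hbar2.incl B φ₀, ζ), (ψ' : H) + Gl hB τ hm ξ),
      ⟨φ₀, hr.symm, (congrArg Θ hc).trans hbc⟩, ⟨_, hV.symm⟩⟩, rfl,
      WithLp.ofLp_injective 2 (Prod.ext (Kbar1.mk_eq_equiv i₁ _ Θ hΘ hΘi hU _ hV)
        (congrArg (Abar B) (Subtype.ext hr)))⟩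

theorem surjective_sub_WTheta (hB : IsSelfAdjoint B) (hBi : ∀ x : B.domain, B x = 0 → x = 0)
    (hΘ : Θ.IsPositive) (hΘi : Function.Injective Θ) (hS : Function.Surjective (tauSub τ Θ))
    (H32 : IsCommonSpace B i₀ i₁) (hU : Function.Injective (sumMap i₁ g)) {m : ℝ} (hm : m ≠ 0)
    (hg : g = G hB τ i₀ i₁ hm) :
    Function.Surjective fun x : (WTheta i₀ i₁ g Θ hΘ hΘi hU τ).domain =>
      (m : 𝕜) • (x : KTot i₁ g Θ hΘ hΘi hU) - WTheta i₀ i₁ g Θ hΘ hΘi hU τ x := by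
  intro y
  obtain ⟨⟨⟨a, b⟩, c⟩, rfl⟩ := (KTot.ofParts i₁ g Θ hΘ hΘi hU).surjective y
  have hm' : (m : 𝕜) ≠ 0 := by exact_mod_cast hm
  obtain ⟨χ, ψ', ha, hc⟩ := exists_resolvent_W hB hBi hm a c
  obtain ⟨ξ, hξ⟩ := surjective_chargeOp hB hΘ hS hm ((m : 𝕜) • τ χ - Θ b)
  rw [chargeOp_apply] at hξ
  have hbc : Θ ((m : 𝕜)⁻¹ • (ξ + b)) = τ (χ - (m : 𝕜) • Gbar2 hB τ hm ξ) := by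
    rw [map_smul, inv_smul_eq_iff₀ hm', map_add, map_sub, map_smul, smul_sub, smul_smul,
      ← pow_two, eq_sub_iff_add_eq, add_right_comm, hξ, sub_add_cancel]
  obtain ⟨x, hx, hx'⟩ := (LinearPMap.mem_graph_iff _).1
    ((mem_graph_WTheta hB hΘ hΘi H32 hU hm hg _ _).2 ⟨_, ψ', _, ξ, hbc, rfl, rfl⟩)
  refine ⟨x, ?_⟩
  dsimp only
  rw [hx', hx, ← map_smul, ← map_sub]
  refine congrArg _ (Prod.ext (Prod.ext ?_ ?_) ?_) <;> dsimp
  · rw [← ha, map_sub, map_smul, incl_Gbar2, smul_sub, smul_smul, pow_two]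
    abel
  · rw [smul_smul, mul_inv_cancel₀ hm', one_smul, add_sub_cancel_left]
  · rw [← hc, map_sub, map_smul, Abar_Gbar2, smul_add, smul_neg]
    abel

theorem dense_boundaryCondition (hB : IsSelfAdjoint B) (hBi : ∀ x : B.domain, B x = 0 → x = 0)
    (hτ : DenseRange τ) (hS : Function.Surjective (tauSub τ Θ))
    (H31 : Set.range (tauStar hB τ) ∩ HNegOne hB = {0}) :
    Dense ((inclL B).prodMap (ContinuousLinearMap.id 𝕜 h) '' {x | tauSub τ Θ x = 0}) := by
  have := completeSpace_Hbar2 hB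
  refine dense_image_ker hS ((denseRange_inclL hB hBi).prodMap denseRange_id) fun f F hf =>
    eq_zero_of_comp_tau_eq hB hBi hτ H31 f (F.comp (ContinuousLinearMap.inl 𝕜 (Hbar1 B) h)) ?_
  ext φ
  simpa [tauSub_apply] using DFunLike.congr_fun hf (φ, 0)

theorem dense_WTheta_domain (hB : IsSelfAdjoint B) (hBi : ∀ x : B.domain, B x = 0 → x = 0)
    (hΘ : Θ.IsPositive) (hΘi : Function.Injective Θ) (hτ : DenseRange τ)
    (hS : Function.Surjective (tauSub τ Θ))
    (H31 : Set.range (tauStar hB τ) ∩ HNegOne hB = {0}) (H32 : IsCommonSpace B i₀ i₁)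
    (hU : Function.Injective (sumMap i₁ g)) {l : ℝ} (hl : l ≠ 0) (hg : g = G hB τ i₀ i₁ hl) :
    Dense ((WTheta i₀ i₁ g Θ hΘ hΘi hU τ).domain : Set (KTot i₁ g Θ hΘ hΘi hU)) := by
  refine ((KTot.ofParts i₁ g Θ hΘ hΘi hU).surjective.denseRange.dense_image
    (KTot.continuous_ofParts i₁ g Θ hΘ hΘi hU)
    ((dense_boundaryCondition hB hBi hτ hS H31).prod hB.dense_domain)).mono ?_
  rintro _ ⟨⟨_, ψ⟩, ⟨⟨⟨φ, ζ⟩, hbc, rfl⟩, hψ⟩, rfl⟩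
  have hbc : Θ ζ = τ φ := (sub_eq_zero.1 ((tauSub_apply τ Θ φ ζ).symm.trans hbc)).symm
  exact LinearPMap.mem_domain_of_mem_graph <| (mem_graph_WTheta hB hΘ hΘi H32 hU hl hg _ _).2
    ⟨φ, ⟨ψ, hψ⟩, ζ, 0, hbc, by rw [map_zero, add_zero]; rfl, rfl⟩

/-- Green's identity with the boundary condition `Θ ζ = τ φ`: the boundary term of `inner_tau` is
the energy of the charges. -/
theorem inner_sub_Gbar_add_inner_charge (hB : IsSelfAdjoint B) (hΘ : Θ.IsPositive) {l : ℝ}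
    (hl : l ≠ 0) {φ : Hbar2 B} {ζ : h} (hbc : Θ ζ = τ φ) (ψ : B.domain) (ξ : h) :
    ⟪toHbar1 B ψ - (l : 𝕜) ^ 2 • Gbar hB τ hl ξ, Hbar2.incl B φ⟫_𝕜 + ⟪Θ ξ, ζ⟫_𝕜 =
      -⟪(ψ : H) + Gl hB τ hl ξ, Abar B φ⟫_𝕜 := by
  have hsymm : ⟪Θ ξ, ζ⟫_𝕜 = ⟪ξ, Θ ζ⟫_𝕜 := hΘ.isSymmetric ξ ζ
  rw [hsymm, hbc, inner_tau hB τ hl, inner_sub_left, inner_smul_left, inner_toHbar1_incl hB,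
    inner_add_left, map_pow, RCLike.conj_ofReal]
  ring

theorem WTheta_skew_symmetric (hB : IsSelfAdjoint B) (hΘ : Θ.IsPositive)
    (hΘi : Function.Injective Θ) (H32 : IsCommonSpace B i₀ i₁)
    (hU : Function.Injective (sumMap i₁ g)) {l : ℝ} (hl : l ≠ 0) (hg : g = G hB τ i₀ i₁ hl)
    (x y : (WTheta i₀ i₁ g Θ hΘ hΘi hU τ).domain) :
    ⟪WTheta i₀ i₁ g Θ hΘ hΘi hU τ x, (y : KTot i₁ g Θ hΘ hΘi hU)⟫_𝕜 =
      -⟪(x : KTot i₁ g Θ hΘ hΘi hU), WTheta i₀ i₁ g Θ hΘ hΘi hU τ y⟫_𝕜 := by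
  obtain ⟨φ, ψ, ζ, ξ, hbc, hx, hWx⟩ := (mem_graph_WTheta hB hΘ hΘi H32 hU hl hg _ _).1
    ((WTheta i₀ i₁ g Θ hΘ hΘi hU τ).mem_graph x)
  obtain ⟨φ', ψ', ζ', ξ', hbc', hy, hWy⟩ := (mem_graph_WTheta hB hΘ hΘi H32 hU hl hg _ _).1
    ((WTheta i₀ i₁ g Θ hΘ hΘi hU τ).mem_graph y)
  rw [← inner_conj_symm (x : KTot i₁ g Θ hΘ hΘi hU), hWx, hy, hWy, hx, KTot.inner_ofParts,
    KTot.inner_ofParts, inner_sub_Gbar_add_inner_charge hB hΘ hl hbc' ψ ξ,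
    inner_sub_Gbar_add_inner_charge hB hΘ hl hbc ψ' ξ', map_add, map_neg, inner_conj_symm,
    inner_conj_symm]
  ring

theorem isSkewAdjoint_WTheta (hB : IsSelfAdjoint B) (hBi : ∀ x : B.domain, B x = 0 → x = 0)
    (hΘ : Θ.IsPositive) (hΘi : Function.Injective Θ) (hτ : DenseRange τ)
    (hS : Function.Surjective (tauSub τ Θ))
    (H31 : Set.range (tauStar hB τ) ∩ HNegOne hB = {0}) (H32 : IsCommonSpace B i₀ i₁)
    (hU : Function.Injective (sumMap i₁ g))
    (hg : ∀ (m : ℝ) (hm : m ≠ 0), g = G hB τ i₀ i₁ hm) :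
    IsSkewAdjoint (WTheta i₀ i₁ g Θ hΘ hΘi hU τ) := by
  have h₁ := surjective_sub_WTheta hB hBi hΘ hΘi hS H32 hU one_ne_zero (hg 1 one_ne_zero)
  have h₂ := surjective_sub_WTheta hB hBi hΘ hΘi hS H32 hU (neg_ne_zero.2 one_ne_zero) (hg (-1) _)
  exact isSkewAdjoint_of_surjective
    (dense_WTheta_domain hB hBi hΘ hΘi hτ hS H31 H32 hU one_ne_zero (hg 1 _))
    (WTheta_skew_symmetric hB hΘ hΘi H32 hU one_ne_zero (hg 1 _)) h₁ (by simpa using h₂)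

theorem WTilde_graph (hB : IsSelfAdjoint B) (hBi : ∀ x : B.domain, B x = 0 → x = 0)
    (hΘ : Θ.IsPositive) (hΘi : Function.Injective Θ) (hτ : DenseRange τ)
    (H31 : Set.range (tauStar hB τ) ∩ HNegOne hB = {0}) {l : ℝ} (hl : l ≠ 0) :
    (WTilde hB τ Θ hΘ hΘi hl).graph = WTildeGraph hB τ Θ hΘ hΘi hl := by
  refine Submodule.toLinearPMap_graph_eq _ ?_
  rintro ⟨_, _⟩ ⟨φ₀, ψ', ζ, ξ, -, rfl, rfl⟩ hzero
  have hφ₀ : φ₀ = 0 :=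
    Subtype.ext (congrArg (fun z : HTot B Θ hΘ hΘi => z.fst) hzero)
  have hψ : (ψ' : H) + Gl hB τ hl ξ = 0 :=
    congrArg (fun z : HTot B Θ hΘ hΘi => z.snd.fst) hzero
  have hξ : ξ = 0 := eq_zero_of_Gl_mem hB hBi hτ H31 hl <| by
    rw [← neg_eq_of_add_eq_zero_right hψ]
    exact (-ψ').2
  have hψ' : ψ' = 0 := Subtype.ext (by simpa [hξ] using hψ)
  simp [hφ₀, hξ, hψ']

theorem WTheta_graph_eq_map (hB : IsSelfAdjoint B) (hΘ : Θ.IsPositive)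
    (hΘi : Function.Injective Θ) (H32 : IsCommonSpace B i₀ i₁) {l : ℝ} (hl : l ≠ 0)
    (hU : Function.Injective (sumMap i₁ (G hB τ i₀ i₁ hl))) :
    (WTheta i₀ i₁ (G hB τ i₀ i₁ hl) Θ hΘ hΘi hU τ).graph =
      (WTildeGraph hB τ Θ hΘ hΘi hl).map
        ((KTot.isometryEquiv i₁ _ Θ hΘ hΘi hU).toLinearEquiv.toLinearMap.prodMap
          (KTot.isometryEquiv i₁ _ Θ hΘ hΘi hU).toLinearEquiv.toLinearMap) := by
  ext ⟨x, y⟩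
  rw [mem_graph_WTheta hB hΘ hΘi H32 hU hl rfl, Submodule.mem_map]
  constructor
  · rintro ⟨φ₀, ψ', ζ, ξ, hbc, rfl, rfl⟩
    exact ⟨(_, _), ⟨φ₀, ψ', ζ, ξ, hbc, rfl, rfl⟩, rfl⟩
  · rintro ⟨⟨_, _⟩, ⟨φ₀, ψ', ζ, ξ, hbc, rfl, rfl⟩, hxy⟩
    exact ⟨φ₀, ψ', ζ, ξ, hbc, (congrArg Prod.fst hxy).symm, (congrArg Prod.snd hxy).symm⟩

end PerturbedWave

section Comparison

variable {𝕜 H h V : Type*} [RCLike 𝕜]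
variable [NormedAddCommGroup H] [InnerProductSpace 𝕜 H] [CompleteSpace H]
variable [NormedAddCommGroup h] [InnerProductSpace 𝕜 h] [CompleteSpace h]
variable [AddCommGroup V] [Module 𝕜 V]
variable {B : H →ₗ.[𝕜] H} {Θ : h →L[𝕜] h} {τ : Hbar2 B →L[𝕜] h}
variable {i₀ : H →ₗ[𝕜] V} {i₁ : Hbar1 B →ₗ[𝕜] V} {g : h →ₗ[𝕜] V}
variable {hΘ : Θ.IsPositive} {hΘi : Function.Injective Θ}

theorem mem_domain_W_and_incl_mem_domain_WTheta_iff (H32 : IsCommonSpace B i₀ i₁)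
    (hU : Function.Injective (sumMap i₁ g)) (x : WithLp 2 (Hbar1 B × H)) :
    (x ∈ (W B).domain ∧ incl i₁ g Θ hΘ hΘi hU x ∈ (WTheta i₀ i₁ g Θ hΘ hΘi hU τ).domain) ↔
      (∃ φ : Hbar2 B, τ φ = 0 ∧ Hbar2.incl B φ = x.fst) ∧ x.snd ∈ B.domain := by
  have hr := Kbar1.reg_equiv i₁ g Θ hΘ hΘi hU (x.fst, 0)
  have hc := (congrArg Θ (Kbar1.charge_equiv i₁ g Θ hΘ hΘi hU (x.fst, 0))).trans (map_zero Θ)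
  constructor
  · rintro ⟨hx, ⟨φ, hφ, hbc⟩, -⟩
    exact ⟨⟨φ, hbc.symm.trans hc, hφ.trans hr⟩, hx.2⟩
  · rintro ⟨⟨φ, hτφ, hφ⟩, hx⟩
    have hV : sumMap i₁ g (toHbar1 B ⟨x.snd, hx⟩, 0) = i₀ x.snd := by
      simp [sumMap, H32.compat ⟨x.snd, hx⟩]
    have hx₁ : x.fst ∈ hbar2 B := hφ ▸ φ.2
    exact ⟨⟨hx₁, hx⟩, ⟨φ, hφ.trans hr.symm, hc.trans hτφ.symm⟩, ⟨_, hV⟩⟩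

theorem WTheta_incl (H32 : IsCommonSpace B i₀ i₁) (hU : Function.Injective (sumMap i₁ g))
    (x : WithLp 2 (Hbar1 B × H)) (hx : x ∈ (W B).domain)
    (hx' : incl i₁ g Θ hΘ hΘi hU x ∈ (WTheta i₀ i₁ g Θ hΘ hΘi hU τ).domain) :
    WTheta i₀ i₁ g Θ hΘ hΘi hU τ ⟨_, hx'⟩ = incl i₁ g Θ hΘ hΘi hU (W B ⟨x, hx⟩) := by
  refine WithLp.ofLp_injective 2 (Prod.ext ?_ ?_)
  · refine Kbar1.mk_eq_equiv i₁ g Θ hΘ hΘi hU _ (p := (toHbar1 B ⟨x.snd, hx.2⟩, 0)) ?_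
    exact (H32.compat ⟨x.snd, hx.2⟩).trans (by simp [sumMap])
  · exact congrArg (Abar B) (Subtype.ext (Kbar1.reg_equiv i₁ g Θ hΘ hΘi hU (x.fst, 0)))

theorem dense_ker_tau (hB : IsSelfAdjoint B) (hBi : ∀ x : B.domain, B x = 0 → x = 0)
    (hτ : Function.Surjective τ) (H31 : Set.range (tauStar hB τ) ∩ HNegOne hB = {0}) :
    Dense {x : WithLp 2 (Hbar1 B × H) |
      (∃ φ : Hbar2 B, τ φ = 0 ∧ Hbar2.incl B φ = x.fst) ∧ x.snd ∈ B.domain} := by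
  have := completeSpace_Hbar2 hB
  have hker : Dense (inclL B '' {φ | τ φ = 0}) :=
    dense_image_ker hτ (denseRange_inclL hB hBi)
      (eq_zero_of_comp_tau_eq hB hBi hτ.denseRange H31)
  exact (hker.prod hB.dense_domain).preimage (WithLp.homeomorphProd 2 (Hbar1 B) H).isOpenMap

end Comparison

end AbstractWave

end

open AbstractWave in
theorem theorem3p6 {𝕜 H h V : Type*} [RCLike 𝕜]
    [NormedAddCommGroup H] [InnerProductSpace 𝕜 H] [CompleteSpace H]
    [NormedAddCommGroup h] [InnerProductSpace 𝕜 h] [CompleteSpace h]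
    [AddCommGroup V] [Module 𝕜 V]
    -- the injective self-adjoint operator `B`
    (B : H →ₗ.[𝕜] H) (hB : IsSelfAdjoint B) (hBi : ∀ x : B.domain, B x = 0 → x = 0)
    -- the bounded, positive and injective self-adjoint operator `Θ`
    (Θ : h →L[𝕜] h) (hΘ : Θ.IsPositive) (hΘi : Function.Injective Θ)
    (τ : Hbar2 B →L[𝕜] h) (hτ : DenseRange τ)
    (H30 : LinearMap.range (tauTheta τ Θ) = ⊤)
    (H31 : Set.range (tauStar hB τ) ∩ HNegOne hB = {0})
    (i₀ : H →ₗ[𝕜] V) (i₁ : Hbar1 B →ₗ[𝕜] V) (H32 : IsCommonSpace B i₀ i₁)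
    (l : ℝ) (hl : l ≠ 0) :
    -- the map `G` does not depend on `l`
    (∀ (m : ℝ) (hm : m ≠ 0), G hB τ i₀ i₁ hm = G hB τ i₀ i₁ hl) ∧
    -- the decomposition `φ = φ₀ + G ζ` is unique
    ∃ hU : Function.Injective (sumMap i₁ (G hB τ i₀ i₁ hl)),
      -- `W_Θ` is skew-adjoint, its resolvent exists at every real `m ≠ 0`, and the space on which
      -- it acts is complete if `Θ` is surjective
      IsSkewAdjoint (WTheta i₀ i₁ (G hB τ i₀ i₁ hl) Θ hΘ hΘi hU τ) ∧
      (∀ m : ℝ, m ≠ 0 → ∀ y, ∃ x : (WTheta i₀ i₁ (G hB τ i₀ i₁ hl) Θ hΘ hΘi hU τ).domain,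
        (m : 𝕜) • (x : KTot i₁ (G hB τ i₀ i₁ hl) Θ hΘ hΘi hU) -
          WTheta i₀ i₁ (G hB τ i₀ i₁ hl) Θ hΘ hΘi hU τ x = y) ∧
      (Function.Surjective Θ → CompleteSpace (KTot i₁ (G hB τ i₀ i₁ hl) Θ hΘ hΘi hU)) ∧
      -- `W_Θ = U W̃_Θ U*`, with the unitary map `U(φ₀, ψ, ζ) = (φ₀ + G ζ, ψ)`
      (WTilde hB τ Θ hΘ hΘi hl).graph = WTildeGraph hB τ Θ hΘ hΘi hl ∧
      (∃ U : HTot B Θ hΘ hΘi ≃ₗᵢ[𝕜] KTot i₁ (G hB τ i₀ i₁ hl) Θ hΘ hΘi hU,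
        (∀ (φ₀ : Hbar1 B) (ψ : H) (ζ : h),
          U (WithLp.toLp 2 (φ₀, WithLp.toLp 2 (ψ, (HTheta.val Θ hΘ hΘi).symm ζ))) =
            WithLp.toLp 2 (Kbar1.mk i₁ (G hB τ i₀ i₁ hl) Θ hΘ hΘi hU
              (i₁ φ₀ + G hB τ i₀ i₁ hl ζ) ⟨(φ₀, ζ), rfl⟩, ψ)) ∧
        (WTheta i₀ i₁ (G hB τ i₀ i₁ hl) Θ hΘ hΘi hU τ).graph =
          (WTilde hB τ Θ hΘ hΘi hl).graph.map
            (U.toLinearEquiv.toLinearMap.prodMap U.toLinearEquiv.toLinearMap)) ∧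
      -- the inclusion of `H̄₁ ⊕ H` in `K̄₁ ⊕ H` is isometric
      (∀ x, ‖incl i₁ (G hB τ i₀ i₁ hl) Θ hΘ hΘi hU x‖ = ‖x‖) ∧
      -- `D(W) ∩ D(W_Θ) = Ker τ ⊕ H₁`
      (∀ x : WithLp 2 (Hbar1 B × H),
        (x ∈ (W B).domain ∧ incl i₁ (G hB τ i₀ i₁ hl) Θ hΘ hΘi hU x ∈
            (WTheta i₀ i₁ (G hB τ i₀ i₁ hl) Θ hΘ hΘi hU τ).domain) ↔
          (∃ φ : Hbar2 B, τ φ = 0 ∧ Hbar2.incl B φ = x.fst) ∧ x.snd ∈ B.domain) ∧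
      -- `W` and `W_Θ` coincide there
      (∀ (x : WithLp 2 (Hbar1 B × H)) (hx : x ∈ (W B).domain)
        (hx' : incl i₁ (G hB τ i₀ i₁ hl) Θ hΘ hΘi hU x ∈
          (WTheta i₀ i₁ (G hB τ i₀ i₁ hl) Θ hΘ hΘi hU τ).domain),
        WTheta i₀ i₁ (G hB τ i₀ i₁ hl) Θ hΘ hΘi hU τ ⟨_, hx'⟩ =
          incl i₁ (G hB τ i₀ i₁ hl) Θ hΘ hΘi hU (W B ⟨x, hx⟩)) ∧
      -- `W_Θ` is a singular perturbation of `W` if `Ker τ ⊕ H₁` is dense in `H̄₁ ⊕ H`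
      (Dense {x : WithLp 2 (Hbar1 B × H) |
          (∃ φ : Hbar2 B, τ φ = 0 ∧ Hbar2.incl B φ = x.fst) ∧ x.snd ∈ B.domain} →
        IsSingularPerturbation (incl i₁ (G hB τ i₀ i₁ hl) Θ hΘ hΘi hU) (W B)
          (WTheta i₀ i₁ (G hB τ i₀ i₁ hl) Θ hΘ hΘi hU τ)) ∧
      -- and `Ker τ ⊕ H₁` is dense if `τ` is surjective
      (Function.Surjective τ →
        Dense {x : WithLp 2 (Hbar1 B × H) |
          (∃ φ : Hbar2 B, τ φ = 0 ∧ Hbar2.incl B φ = x.fst) ∧ x.snd ∈ B.domain}) := by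
  have hS := tauSub_surjective H30
  have hU := sumMap_injective hB hBi hτ H31 H32 hl
  have hG : ∀ {m m' : ℝ} (hm : m ≠ 0) (hm' : m' ≠ 0), G hB τ i₀ i₁ hm = G hB τ i₀ i₁ hm' :=
    fun hm hm' => G_eq_G hB hBi τ H32 hm' hm
  have hskew := isSkewAdjoint_WTheta hB hBi hΘ hΘi hτ hS H31 H32 hU fun _ hm => hG hl hm
  have hgraph := WTilde_graph hB hBi hΘ hΘi hτ H31 hl
  have hUgraph := hgraph ▸ WTheta_graph_eq_map hB hΘ hΘi H32 hl hU
  have hdom := mem_domain_W_and_incl_mem_domain_WTheta_iff (τ := τ) (hΘ := hΘ) (hΘi := hΘi) H32 hU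
  have hcoin := WTheta_incl (τ := τ) (hΘ := hΘ) (hΘi := hΘi) H32 hU
  refine ⟨fun m hm => hG hm hl, hU, hskew,
    fun m hm => surjective_sub_WTheta hB hBi hΘ hΘi hS H32 hU hm (hG hl hm),
    completeSpace_KTot i₁ _ Θ hΘ hΘi hU, hgraph,
    ⟨KTot.isometryEquiv i₁ _ Θ hΘ hΘi hU, KTot.isometryEquiv_toLp i₁ _ Θ hΘ hΘi hU, hUgraph⟩,
    norm_incl i₁ _ Θ hΘ hΘi hU, hdom, hcoin,
    fun hd => ⟨isSkewAdjoint_W hB hBi, hskew, hd.mono fun x hx => ?_⟩,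
    fun hτs => dense_ker_tau hB hBi hτs H31⟩
  obtain ⟨hW, hWΘ⟩ := (hdom x).2 hx
  exact ⟨hW, hWΘ, hcoin x hW hWΘ⟩
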